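/- Let $\mathbb{F}$ be a field and $G$ an abelian group. Algebras are $\mathbb{F}$-vector spaces with a bilinear product (not necessarily associative, unital or finite-dimensional). For an abelian group $K$, a $K$-grading on an algebra $\mathcal{A}$ is a decomposition $\mathcal{A}=\bigoplus_{k\in K}\mathcal{A}_k$ with $\mathcal{A}_k\mathcal{A}_l\subseteq\mathcal{A}_{kl}$, and $\mathcal{A}\simeq_K\mathcal{A}'$ means that there is an algebra isomorphism $\varphi$ with $\varphi(\mathcal{A}_k)=\mathcal{A}'_k$ for all $k\in K$. The centroid is $C(\mathcal{A})=\{c\in\mathrm{End}_{\mathbb{F}}(\mathcal{A})\mid c(xy)=c(x)y=xc(y)\ \forall x,y\in\mathcal{A}\}$. An algebra is *central simple* if it is nonzero, $\mathcal{A}^2=\mathcal{A}$, its only ideals are $0$ and $\mathcal{A}$, and $C(\mathcal{A})=\mathbb{F}1$. A $G$-graded algebra $\mathcal{B}$ is *graded-central-simple* if it is nonzero, $\mathcal{B}^2=\mathcal{B}$, its only graded ideals are $0$ and $\mathcal{B}$, and the only $c\in C(\mathcal{B})$ with $c(\mathcal{B}_g)\subseteq\mathcal{B}_g$ for all $g\in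 G$ are the scalars. For abelian groups $K$, $E$ let $\mathrm{Z}^2_{\mathrm{sym}}(K,E)$ be the group of symmetric $2$-cocycles $K\times K\to E$ (trivial action), $\mathrm{B}^2(K,E)$ the subgroup of coboundaries $(k,l)\mapsto\gamma(k)\gamma(l)\gamma(kl)^{-1}$ with $\gamma:K\to E$ any map, and $\mathrm{H}^2_{\mathrm{sym}}(K,E)=\mathrm{Z}^2_{\mathrm{sym}}(K,E)/\mathrm{B}^2(K,E)$. For a $K$-graded algebra $\mathcal{A}$ and $\tau\in\mathrm{Z}^2_{\mathrm{sym}}(K,\mathbb{F}^\times)$, the twist $\mathcal{A}^\tau$ is the graded space $\mathcal{A}$ with the product $x*y=\tau(k,l)xy$ for $x\in\mathcal{A}_k$, $y\in\mathcal{A}_l$. Let $H$ be a subgroup of $G$, with projection $\pi:G\to G/H$. For a $G/H$-graded algebra $\mathcal{A}$, let $L_\pi(\mathcal{A})=\bigoplus_{g\in G}\mathcal{A}_{\pi(g)}\otimes g\subseteq\mathcal{A}\otimes_{\mathbb{F}}\mathbb{F}G$ (the loop algebra, a $G$-graded algebra), and for $\tau\in\mathrm{Z}^2_{\mathrm{sym}}(G,\mathbb{F}^\times)$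 let $L_\pi^\tau(\mathcal{A})=(L_\pi(\mathcal{A}))^\tau$. Fix for each $H$ a section $s_H:G/H\to G$ of $\pi$; for $\chi\in\mathrm{Hom}(H,\mathbb{F}^\times)$ let $\mathcal{A}_\chi=\mathcal{A}^{\chi\circ\sigma}$, where $\sigma(x,y)=s_H(x)s_H(y)s_H(xy)^{-1}\in H$. Call two central simple $G/H$-graded algebras equivalent, $\mathcal{A}_1\sim\mathcal{A}_2$, if $(\mathcal{A}_1)_\chi\simeq_{G/H}\mathcal{A}_2$ for some $\chi\in\mathrm{Hom}(H,\mathbb{F}^\times)$; this is an equivalence relation. For every subgroup $H$ of $G$ fix a (set-theoretic) section $\xi_H:\mathrm{H}^2_{\mathrm{sym}}(H,\mathbb{F}^\times)\to\mathrm{H}^2_{\mathrm{sym}}(G,\mathbb{F}^\times)$ of the restriction map $[\tau]\mapsto[\tau|_{H\times H}]$. Let $\overline{\mathfrak{A}}'(G,\mathbb{F})$ be the set of triples $(H,[\tau'],[\mathcal{A}])$ with $H$ a subgroup of $G$, $[\tau']\in\mathrm{H}^2_{\mathrm{sym}}(H,\mathbb{F}^\times)$, and $[\mathcal{A}]$ the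 $\sim$-class of a central simple $G/H$-graded algebra $\mathcal{A}$, and let $\overline{\mathfrak{B}}(G,\mathbb{F})$ be the set of $\simeq_G$-classes of $G$-graded-central-simple algebras. **Corollary.** The algebras $L_\pi^\tau(\mathcal{A})$, with $H$ a subgroup of $G$, $\mathcal{A}$ a central simple $G/H$-graded algebra and $\tau\in\mathrm{Z}^2_{\mathrm{sym}}(G,\mathbb{F}^\times)$, are $G$-graded-central-simple, and the map $$\overline{\mathfrak{A}}'(G,\mathbb{F})\longrightarrow\overline{\mathfrak{B}}(G,\mathbb{F}),\qquad (H,[\tau'],[\mathcal{A}])\mapsto[L_\pi^\tau(\mathcal{A})],$$ where $\tau$ is any cocycle in $\mathrm{Z}^2_{\mathrm{sym}}(G,\mathbb{F}^\times)$ with $[\tau]=\xi_H([\tau'])$, is well defined and bijective. -/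

import Mathlib

universe u v w

/-! ### Symmetric 2-cocycles and symmetric second cohomology -/

namespace SymCoh

/-- The group of symmetric 2-cocycles `A × A → B` (trivial action). -/
def Z2sym (A B : Type*) [CommGroup A] [CommGroup B] : Subgroup (A → A → B) where
  carrier := {σ | (∀ a₁ a₂ a₃, σ a₁ a₂ * σ (a₁ * a₂) a₃ = σ a₁ (a₂ * a₃) * σ a₂ a₃) ∧
    ∀ a₁ a₂, σ a₁ a₂ = σ a₂ a₁}
  one_mem' := by simp
  mul_mem' := by
    rintro σ τ ⟨hσ, hσ'⟩ ⟨hτ, hτ'⟩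
    refine ⟨fun a b c => ?_, fun a b => ?_⟩
    · simp only [Pi.mul_apply]
      rw [mul_mul_mul_comm, hσ, hτ, mul_mul_mul_comm]
    · simp only [Pi.mul_apply]
      rw [hσ', hτ']
  inv_mem' := by
    rintro σ ⟨hσ, hσ'⟩
    refine ⟨fun a b c => ?_, fun a b => ?_⟩
    · simp only [Pi.inv_apply]
      rw [← mul_inv, ← mul_inv, hσ]
    · simp only [Pi.inv_apply]
      rw [hσ']

/-- The coboundary map `(dγ)(a₁, a₂) = γ(a₁) γ(a₂) γ(a₁ a₂)⁻¹`. -/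
def d (A B : Type*) [CommGroup A] [CommGroup B] : (A → B) →* (A → A → B) where
  toFun γ := fun a₁ a₂ => γ a₁ * γ a₂ * (γ (a₁ * a₂))⁻¹
  map_one' := by ext; simp
  map_mul' γ γ' := by
    ext a b
    simp only [Pi.mul_apply, mul_inv]
    ac_rfl

/-- The group of 2-coboundaries. -/
def B2 (A B : Type*) [CommGroup A] [CommGroup B] : Subgroup (A → A → B) := (d A B).range

/-- `H²_sym(A, B) = Z²_sym(A, B) / B²(A, B)`. -/
abbrev H2sym (A B : Type*) [CommGroup A] [CommGroup B] : Type _ :=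
  Z2sym A B ⧸ (B2 A B).subgroupOf (Z2sym A B)

/-- Pullback of symmetric cocycles along a homomorphism: `σ ↦ σ ∘ (f × f)`. -/
def Z2sym.pullback {A A' : Type*} (B : Type*) [CommGroup A] [CommGroup A'] [CommGroup B]
    (f : A' →* A) : Z2sym A B →* Z2sym A' B where
  toFun σ := ⟨fun a₁ a₂ => σ.1 (f a₁) (f a₂),
    fun a₁ a₂ a₃ => by simpa only [map_mul] using σ.2.1 (f a₁) (f a₂) (f a₃),
    fun a₁ a₂ => σ.2.2 _ _⟩
  map_one' := rfl
  map_mul' _ _ := rfl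

/-- The map `f^* : H²_sym(A, B) → H²_sym(A', B)`, `[σ] ↦ [σ ∘ (f × f)]`. -/
def H2sym.pullback {A A' : Type*} (B : Type*) [CommGroup A] [CommGroup A'] [CommGroup B]
    (f : A' →* A) : H2sym A B →* H2sym A' B :=
  QuotientGroup.map _ _ (Z2sym.pullback B f) (by
    rintro ⟨σ, hσ⟩ ⟨γ, hγ⟩
    refine ⟨γ ∘ f, ?_⟩
    subst hγ
    ext a b
    simp [d, Z2sym.pullback])

end SymCoh

/-! ### Sections of `G → G/H` and the associated cocycles -/

/-- A (set-theoretic) section of the canonical projection `G → G/H`. -/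
def QuotSection {G : Type*} [CommGroup G] (H : Subgroup G) : Type _ :=
  {s : G ⧸ H → G // ∀ x, (QuotientGroup.mk (s x) : G ⧸ H) = x}

namespace QuotSection

variable {G : Type*} [CommGroup G] {H : Subgroup G}

/-- The element `s(x) s(y) s(xy)⁻¹` of `H`. -/
def sigma (s : QuotSection H) (x y : G ⧸ H) : H :=
  ⟨s.1 x * s.1 y * (s.1 (x * y))⁻¹, by
    rw [← QuotientGroup.eq_one_iff]
    simp [QuotientGroup.mk_mul, QuotientGroup.mk_inv, s.2]⟩

/-- For a homomorphism `χ : H → B`, the symmetric cocycle `χ ∘ σ` on `G/H`. -/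
def charCocycle {B : Type*} [CommGroup B] (s : QuotSection H) (χ : H →* B) :
    SymCoh.Z2sym (G ⧸ H) B :=
  ⟨fun x y => χ (s.sigma x y), fun x y z => by
      rw [← map_mul, ← map_mul]
      congr 1
      ext
      simp only [sigma, Subgroup.coe_mul, mul_assoc x y z]
      generalize s.1 x = a
      generalize s.1 y = b
      generalize s.1 z = c
      generalize s.1 (x * y) = e
      generalize s.1 (y * z) = f
      generalize s.1 (x * (y * z)) = k
      have h1 : a * b * e⁻¹ * (e * c * k⁻¹) = a * b * c * k⁻¹ := by group
      have h2 : a * f * k⁻¹ * (b * c * f⁻¹) = a * b * c * k⁻¹ * (f * f⁻¹) := by ac_rfl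
      rw [h1, h2]; simp,
    fun x y => by
      have h : s.sigma x y = s.sigma y x := by
        ext
        simp only [sigma]
        rw [mul_comm (s.1 x), mul_comm x]
      simp only [h]⟩

end QuotSection

/-! ### Algebras (vector spaces with a bilinear product): ideals, centroid, simplicity -/

namespace BilinAlg

variable {F : Type*} [Field F] {A : Type*} [AddCommGroup A] [Module F A]

/-- Two-sided ideals of the algebra `A` with product `m`. -/
def IsIdeal (m : A →ₗ[F] A →ₗ[F] A) (I : Submodule F A) : Prop :=
  ∀ a, ∀ x ∈ I, m a x ∈ I ∧ m x a ∈ I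

/-- The centroid, `{c ∈ End_F(A) | c(xy) = c(x)y = xc(y)}`. -/
def centroid (m : A →ₗ[F] A →ₗ[F] A) : Subalgebra F (Module.End F A) where
  carrier := {c | ∀ x y, c (m x y) = m (c x) y ∧ c (m x y) = m x (c y)}
  mul_mem' := by
    intro c c' hc hc' x y
    simp only [Module.End.mul_apply]
    exact ⟨by rw [(hc' x y).1, (hc _ _).1], by rw [(hc' x y).2, (hc _ _).2]⟩
  add_mem' := by
    intro c c' hc hc' x y
    simp only [LinearMap.add_apply, map_add]
    exact ⟨by rw [(hc x y).1, (hc' x y).1], by rw [(hc x y).2, (hc' x y).2]⟩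
  algebraMap_mem' := by
    intro r x y
    simp [Module.algebraMap_end_apply]

/-- `A` is simple: `A ≠ 0`, `A² = A`, and the only ideals are `0` and `A`. -/
def IsSimple (m : A →ₗ[F] A →ₗ[F] A) : Prop :=
  Nontrivial A ∧ Submodule.map₂ m ⊤ ⊤ = ⊤ ∧
    ∀ I : Submodule F A, IsIdeal m I → I = ⊥ ∨ I = ⊤

/-- `A` is central simple: it is simple with centroid `F 1`. -/
def IsCentralSimple (m : A →ₗ[F] A →ₗ[F] A) : Prop :=
  IsSimple m ∧ centroid m = ⊥

end BilinAlg

/-! ### Graded algebras -/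

/-- An algebra over `F` (a vector space with an arbitrary bilinear product) with a `G`-grading. -/
structure GradedAlg (F : Type u) [Field F] (G : Type v) [CommGroup G] where
  carrier : Type w
  [addCommGroup : AddCommGroup carrier]
  [module : Module F carrier]
  mul : carrier →ₗ[F] carrier →ₗ[F] carrier
  comp : G → Submodule F carrier
  indep : iSupIndep comp
  iSup_eq_top : ⨆ g, comp g = ⊤
  mul_mem : ∀ g h x y, x ∈ comp g → y ∈ comp h → mul x y ∈ comp (g * h)

namespace GradedAlg

attribute [instance] GradedAlg.addCommGroup GradedAlg.module

section

variable {F : Type u} [Field F] {G : Type v} [CommGroup G]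

/-- Graded isomorphism: an algebra isomorphism `φ` with `φ(A_g) = B_g` for all `g`. -/
def Iso (A B : GradedAlg.{u, v, w} F G) : Prop :=
  ∃ φ : A.carrier ≃ₗ[F] B.carrier, (∀ x y, φ (A.mul x y) = B.mul (φ x) (φ y)) ∧
    ∀ g, (A.comp g).map (φ : A.carrier →ₗ[F] B.carrier) = B.comp g

/-- Graded ideals: ideals `I` with `I = ⨁ (I ∩ A_g)`. -/
def IsGradedIdeal (A : GradedAlg.{u, v, w} F G) (I : Submodule F A.carrier) : Prop :=
  BilinAlg.IsIdeal A.mul I ∧ I = ⨆ g, I ⊓ A.comp g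

/-- `C(A)_g = {c ∈ C(A) | c A_{g'} ⊆ A_{gg'} for all g'}`. -/
def centroidComp (A : GradedAlg.{u, v, w} F G) (g : G) : Submodule F (Module.End F A.carrier) where
  carrier := {c | c ∈ BilinAlg.centroid A.mul ∧ ∀ g', ∀ x ∈ A.comp g', c x ∈ A.comp (g * g')}
  add_mem' := by
    rintro a b ⟨ha, ha'⟩ ⟨hb, hb'⟩
    exact ⟨add_mem ha hb, fun g' x hx => add_mem (ha' g' x hx) (hb' g' x hx)⟩
  zero_mem' := ⟨zero_mem _, fun g' x _ => zero_mem _⟩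
  smul_mem' := by
    rintro r a ⟨ha, ha'⟩
    exact ⟨Subalgebra.smul_mem _ ha r, fun g' x hx => Submodule.smul_mem _ r (ha' g' x hx)⟩

/-- Graded-central: `C(A)_e = F 1`. -/
def IsGradedCentral (A : GradedAlg.{u, v, w} F G) : Prop :=
  A.centroidComp 1 = Submodule.span F {1}

/-- Graded-simple: `A ≠ 0`, `A² = A`, and the only graded ideals are `0` and `A`. -/
def IsGradedSimple (A : GradedAlg.{u, v, w} F G) : Prop :=
  Nontrivial A.carrier ∧ Submodule.map₂ A.mul ⊤ ⊤ = ⊤ ∧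
    ∀ I, A.IsGradedIdeal I → I = ⊥ ∨ I = ⊤

/-- Graded-central-simple. -/
def IsGradedCentralSimple (A : GradedAlg.{u, v, w} F G) : Prop :=
  A.IsGradedSimple ∧ A.IsGradedCentral

/-- Central simple as an ungraded algebra. -/
def IsCentralSimple (A : GradedAlg.{u, v, w} F G) : Prop :=
  BilinAlg.IsCentralSimple A.mul

/-! #### Cocycle twists -/

open Classical in
/-- The decomposition of `A` as the direct sum of its homogeneous components. -/
noncomputable def decomp (A : GradedAlg.{u, v, w} F G) :
    (DirectSum G fun g => A.comp g) ≃ₗ[F] A.carrier :=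
  LinearEquiv.ofBijective (DirectSum.coeLinearMap A.comp)
    (DirectSum.isInternal_submodule_of_iSupIndep_of_iSup_eq_top A.indep A.iSup_eq_top)

open Classical in
theorem decomp_symm_of_mem (A : GradedAlg.{u, v, w} F G) {g : G} {x : A.carrier}
    (hx : x ∈ A.comp g) :
    A.decomp.symm x = DirectSum.lof F G (fun g => A.comp g) g ⟨x, hx⟩ := by
  rw [LinearEquiv.symm_apply_eq]
  exact (DirectSum.coeLinearMap_lof A.comp g ⟨x, hx⟩).symm

open Classical in
/-- The linear map acting on `A_g` as multiplication by the scalar `c g`. -/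
noncomputable def scale (A : GradedAlg.{u, v, w} F G) (c : G → F) : A.carrier →ₗ[F] A.carrier :=
  (DirectSum.toModule F G A.carrier fun g => c g • (A.comp g).subtype) ∘ₗ
    (A.decomp.symm : A.carrier →ₗ[F] _)

open Classical in
/-- The twisted product: `x * y = τ(g, h) x y` for `x ∈ A_g`, `y ∈ A_h` (see
`twistMul_of_mem`), extended bilinearly. -/
noncomputable def twistMul (A : GradedAlg.{u, v, w} F G) (τ : G → G → F) :
    A.carrier →ₗ[F] A.carrier →ₗ[F] A.carrier :=
  (DirectSum.toModule F G (A.carrier →ₗ[F] A.carrier) fun g =>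
    (A.mul ∘ₗ (A.comp g).subtype).compl₂ (A.scale (τ g))) ∘ₗ
    (A.decomp.symm : A.carrier →ₗ[F] _)

theorem scale_of_mem (A : GradedAlg.{u, v, w} F G) (c : G → F) {g : G} {x : A.carrier}
    (hx : x ∈ A.comp g) : A.scale c x = c g • x := by
  classical
  simp only [scale, LinearMap.comp_apply, LinearEquiv.coe_coe]
  rw [decomp_symm_of_mem A hx, DirectSum.toModule_lof]
  simp

theorem twistMul_of_mem (A : GradedAlg.{u, v, w} F G) (τ : G → G → F) {g h : G}
    {x y : A.carrier} (hx : x ∈ A.comp g) (hy : y ∈ A.comp h) :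
    A.twistMul τ x y = τ g h • A.mul x y := by
  classical
  simp only [twistMul, LinearMap.comp_apply, LinearEquiv.coe_coe]
  rw [decomp_symm_of_mem A hx, DirectSum.toModule_lof]
  simp [scale_of_mem A _ hy]

/-- The `τ`-twist `A^τ`. -/
noncomputable def twist (A : GradedAlg.{u, v, w} F G) (τ : SymCoh.Z2sym G Fˣ) :
    GradedAlg.{u, v, w} F G where
  carrier := A.carrier
  mul := A.twistMul fun g h => (τ.1 g h : F)
  comp := A.comp
  indep := A.indep
  iSup_eq_top := A.iSup_eq_top
  mul_mem g h x y hx hy := by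
    rw [twistMul_of_mem A _ hx hy]
    exact Submodule.smul_mem _ _ (A.mul_mem g h x y hx hy)

/-! #### Graded isomorphism is an equivalence relation -/

theorem Iso.refl (A : GradedAlg.{u, v, w} F G) : Iso A A :=
  ⟨LinearEquiv.refl F _, fun _ _ => rfl, fun g => by simp⟩

theorem Iso.symm {A B : GradedAlg.{u, v, w} F G} (h : Iso A B) : Iso B A := by
  obtain ⟨φ, hm, hc⟩ := h
  refine ⟨φ.symm, fun x y => ?_, fun g => ?_⟩
  · rw [LinearEquiv.symm_apply_eq, hm]; simp
  · rw [← hc g, ← Submodule.map_comp]; simp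

theorem Iso.trans {A B C : GradedAlg.{u, v, w} F G} (h : Iso A B) (h' : Iso B C) : Iso A C := by
  obtain ⟨φ, hm, hc⟩ := h
  obtain ⟨ψ, hm', hc'⟩ := h'
  refine ⟨φ.trans ψ, fun x y => by simp [hm, hm'], fun g => ?_⟩
  rw [← hc' g, ← hc g, ← Submodule.map_comp]; rfl

/-- Two bilinear maps that agree on homogeneous elements are equal. -/
theorem bilin_ext (A : GradedAlg.{u, v, w} F G) {M : Type*} [AddCommGroup M] [Module F M]
    (f f' : A.carrier →ₗ[F] A.carrier →ₗ[F] M)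
    (H : ∀ g h, ∀ x ∈ A.comp g, ∀ y ∈ A.comp h, f x y = f' x y) : f = f' := by
  ext x y
  have hx : x ∈ ⨆ g, A.comp g := by rw [A.iSup_eq_top]; trivial
  have hy : y ∈ ⨆ g, A.comp g := by rw [A.iSup_eq_top]; trivial
  refine Submodule.iSup_induction A.comp (motive := fun x => f x y = f' x y) hx
    (fun g x hx => ?_) (by simp) (fun a b ha hb => by simp [ha, hb])
  exact Submodule.iSup_induction A.comp (motive := fun y => f x y = f' x y) hy
    (fun h y hy => H g h x hx y hy) (by simp) (fun a b ha hb => by simp [ha, hb])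

theorem iso_twist_iff (A B : GradedAlg.{u, v, w} F G) (τ : SymCoh.Z2sym G Fˣ) :
    Iso (A.twist τ) B ↔ ∃ φ : A.carrier ≃ₗ[F] B.carrier,
      (∀ g h, ∀ x ∈ A.comp g, ∀ y ∈ A.comp h,
        (τ.1 g h : F) • φ (A.mul x y) = B.mul (φ x) (φ y)) ∧
      ∀ g, (A.comp g).map (φ : A.carrier →ₗ[F] B.carrier) = B.comp g := by
  have aux : ∀ φ : A.carrier ≃ₗ[F] B.carrier,
      (∀ x y, φ (A.twistMul (fun g h => (τ.1 g h : F)) x y) = B.mul (φ x) (φ y)) ↔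
      (∀ g h, ∀ x ∈ A.comp g, ∀ y ∈ A.comp h,
        (τ.1 g h : F) • φ (A.mul x y) = B.mul (φ x) (φ y)) := by
    refine fun φ => ⟨fun H g h x hx y hy => ?_, fun H => ?_⟩
    · have := H x y
      rwa [twistMul_of_mem A _ hx hy, map_smul] at this
    have key := bilin_ext A
      ((A.twistMul fun g h => (τ.1 g h : F)).compr₂ (φ : A.carrier →ₗ[F] B.carrier))
      (B.mul.compl₁₂ (φ : A.carrier →ₗ[F] B.carrier) (φ : A.carrier →ₗ[F] B.carrier))
      (fun g h x hx y hy => by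
        simp only [LinearMap.compr₂_apply, LinearMap.compl₁₂_apply, LinearEquiv.coe_coe]
        rw [twistMul_of_mem A _ hx hy, map_smul]
        exact H g h x hx y hy)
    exact fun x y => LinearMap.congr_fun (LinearMap.congr_fun key x) y
  exact exists_congr fun φ => and_congr_left fun _ => aux φ

variable (F G) in
/-- Graded isomorphism on the `G`-graded-central-simple algebras. -/
def gcsSetoid : Setoid {B : GradedAlg.{u, v, w} F G // B.IsGradedCentralSimple} where
  r B B' := Iso B.1 B'.1
  iseqv := ⟨fun B => Iso.refl B.1, Iso.symm, Iso.trans⟩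

variable (F G) in
/-- Isomorphism classes of `G`-graded-central-simple algebras. -/
def GCSClass : Type _ := Quotient (gcsSetoid.{u, v, w} F G)

end

/-! ### Loop algebras -/

section

variable {F : Type u} [Field F] {G : Type v} [CommGroup G] {H : Subgroup G}

/-- The product of `A ⊗ F G`, where the element `∑ a_g ⊗ g` is the finitely supported function
`g ↦ a_g`: `(a ⊗ g)(b ⊗ h) = ab ⊗ gh`. -/
noncomputable def groupAlgMul {A : Type*} [AddCommGroup A] [Module F A]
    (m : A →ₗ[F] A →ₗ[F] A) : (G →₀ A) →ₗ[F] (G →₀ A) →ₗ[F] (G →₀ A) :=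
  Finsupp.lsum F fun g => LinearMap.flip <| Finsupp.lsum F fun h =>
    (m.compr₂ (Finsupp.lsingle (g * h))).flip

theorem groupAlgMul_single {A : Type*} [AddCommGroup A] [Module F A]
    (m : A →ₗ[F] A →ₗ[F] A) (g h : G) (a b : A) :
    groupAlgMul m (Finsupp.single g a) (Finsupp.single h b) =
      Finsupp.single (g * h) (m a b) := by
  simp [groupAlgMul]

/-- The subspace `⨁_g A_{π(g)} ⊗ g` of `A ⊗ F G`, for a `G/H`-graded algebra `A`. -/
def loopSubmodule (A : GradedAlg.{u, v, w} F (G ⧸ H)) : Submodule F (G →₀ A.carrier) where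
  carrier := {f | ∀ g : G, f g ∈ A.comp (QuotientGroup.mk g)}
  add_mem' hf hf' g := add_mem (hf g) (hf' g)
  zero_mem' _ := zero_mem _
  smul_mem' r _ hf g := Submodule.smul_mem _ r (hf g)

theorem single_mem_loop (A : GradedAlg.{u, v, w} F (G ⧸ H)) {g : G} {a : A.carrier}
    (ha : a ∈ A.comp (QuotientGroup.mk g)) : Finsupp.single g a ∈ A.loopSubmodule := by
  classical
  intro k
  rw [Finsupp.single_apply]
  split_ifs with hk
  · exact hk ▸ ha
  · exact zero_mem _

theorem groupAlgMul_mem_loop (A : GradedAlg.{u, v, w} F (G ⧸ H)) {f f' : G →₀ A.carrier}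
    (hf : f ∈ A.loopSubmodule) (hf' : f' ∈ A.loopSubmodule) :
    groupAlgMul A.mul f f' ∈ A.loopSubmodule := by
  rw [← f.sum_single, ← f'.sum_single]
  simp only [Finsupp.sum, map_sum, LinearMap.sum_apply, groupAlgMul_single]
  refine Submodule.sum_mem _ fun g _ => Submodule.sum_mem _ fun h _ => ?_
  exact single_mem_loop A (A.mul_mem _ _ _ _ (hf _) (hf' _))

/-- The homogeneous component `A_{π(g)} ⊗ g` of the loop algebra. -/
def loopComp (A : GradedAlg.{u, v, w} F (G ⧸ H)) (g : G) : Submodule F A.loopSubmodule where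
  carrier := {f | ∀ k, k ≠ g → f.1 k = 0}
  add_mem' hf hf' k hk := by simp [hf k hk, hf' k hk]
  zero_mem' _ _ := rfl
  smul_mem' r _ hf k hk := by simp [hf k hk]

theorem loopComp_eq_single (A : GradedAlg.{u, v, w} F (G ⧸ H)) {g : G} {f : A.loopSubmodule}
    (hf : f ∈ A.loopComp g) : f.1 = Finsupp.single g (f.1 g) := by
  classical
  ext k
  rw [Finsupp.single_apply]
  split_ifs with hk
  · rw [hk]
  · exact hf k (Ne.symm hk)

/-- The loop algebra `L_π(A)`, as a `G`-graded algebra. -/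
noncomputable def loop (A : GradedAlg.{u, v, w} F (G ⧸ H)) : GradedAlg.{u, v, max v w} F G where
  carrier := A.loopSubmodule
  mul := LinearMap.mk₂ F
    (fun f f' => ⟨groupAlgMul A.mul f.1 f'.1, groupAlgMul_mem_loop A f.2 f'.2⟩)
    (fun _ _ _ => by ext1; simp) (fun _ _ _ => by ext1; simp)
    (fun _ _ _ => by ext1; simp) (fun _ _ _ => by ext1; simp)
  comp := A.loopComp
  indep := by
    intro g
    rw [Submodule.disjoint_def]
    intro f hf hf'
    have h0 : f.1 g = 0 := by
      have : ⨆ k, ⨆ (_ : k ≠ g), A.loopComp k ≤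
          LinearMap.ker (Finsupp.lapply g ∘ₗ A.loopSubmodule.subtype) :=
        iSup₂_le fun k hk x hx => hx g (Ne.symm hk)
      exact this hf'
    ext1
    rw [loopComp_eq_single A hf, h0]
    simp
  iSup_eq_top := by
    rw [eq_top_iff]
    intro f _
    have : f = ∑ g ∈ f.1.support,
        (⟨Finsupp.single g (f.1 g), single_mem_loop A (f.2 g)⟩ : A.loopSubmodule) := by
      ext1
      rw [AddSubmonoidClass.coe_finsetSum]
      exact f.1.sum_single.symm
    rw [this]
    refine Submodule.sum_mem _ fun g _ => Submodule.mem_iSup_of_mem g fun k hk => ?_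
    exact Finsupp.single_eq_of_ne hk
  mul_mem g h x y hx hy := by
    intro k hk
    change groupAlgMul A.mul x.1 y.1 k = 0
    rw [loopComp_eq_single A hx, loopComp_eq_single A hy, groupAlgMul_single]
    exact Finsupp.single_eq_of_ne hk

/-- The cocycle twisted loop algebra `L_π^τ(A) = (L_π(A))^τ`. -/
noncomputable def twistedLoop (A : GradedAlg.{u, v, w} F (G ⧸ H)) (τ : SymCoh.Z2sym G Fˣ) :
    GradedAlg.{u, v, max v w} F G :=
  A.loop.twist τ

/-! ### Character twists and the set of triples -/

/-- For a character `χ` of `H`, the algebra `A_χ = A^{χ ∘ σ}`, formed with the section `s`. -/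
noncomputable def charTwist (A : GradedAlg.{u, v, w} F (G ⧸ H)) (s : QuotSection H)
    (χ : H →* Fˣ) : GradedAlg.{u, v, w} F (G ⧸ H) :=
  A.twist (s.charCocycle χ)

variable (F) in
/-- The relation `A₁ ∼ A₂` iff `(A₁)_χ ≃ A₂` for some character `χ` of `H`, on the central
simple `G/H`-graded algebras. -/
def charSetoid (s : QuotSection H) :
    Setoid {A : GradedAlg.{u, v, w} F (G ⧸ H) // A.IsCentralSimple} where
  r A₁ A₂ := ∃ χ : H →* Fˣ, Iso (A₁.1.charTwist s χ) A₂.1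
  iseqv := by
    refine ⟨fun A => ⟨1, ?_⟩, ?_, ?_⟩
    · rw [charTwist, iso_twist_iff]
      exact ⟨LinearEquiv.refl F _, fun g h x _ y _ => by simp [QuotSection.charCocycle],
        fun g => by simp⟩
    · rintro A B ⟨χ, h⟩
      refine ⟨χ⁻¹, ?_⟩
      rw [charTwist, iso_twist_iff] at h ⊢
      obtain ⟨φ, hm, hc⟩ := h
      have hc' : ∀ g, (B.1.comp g).map (φ.symm : B.1.carrier →ₗ[F] A.1.carrier) = A.1.comp g :=
        fun g => by rw [← hc g, ← Submodule.map_comp]; simp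
      refine ⟨φ.symm, fun g h x hx y hy => ?_, hc'⟩
      have hx' : φ.symm x ∈ A.1.comp g := hc' g ▸ Submodule.mem_map_of_mem hx
      have hy' : φ.symm y ∈ A.1.comp h := hc' h ▸ Submodule.mem_map_of_mem hy
      have := hm g h _ hx' _ hy'
      simp only [LinearEquiv.apply_symm_apply] at this
      rw [← this, map_smul, smul_smul, LinearEquiv.symm_apply_apply]
      simp [QuotSection.charCocycle]
    · rintro A B C ⟨χ, h⟩ ⟨χ', h'⟩
      refine ⟨χ * χ', ?_⟩
      rw [charTwist, iso_twist_iff] at h h' ⊢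
      obtain ⟨φ, hm, hc⟩ := h
      obtain ⟨ψ, hm', hc'⟩ := h'
      refine ⟨φ.trans ψ, fun g h x hx y hy => ?_, fun g => ?_⟩
      · have hx' : φ x ∈ B.1.comp g := hc g ▸ Submodule.mem_map_of_mem hx
        have hy' : φ y ∈ B.1.comp h := hc h ▸ Submodule.mem_map_of_mem hy
        have e := hm' g h _ hx' _ hy'
        rw [← hm g h x hx y hy, map_smul, smul_smul] at e
        simp only [LinearEquiv.trans_apply]
        rw [← e, mul_comm]
        simp [QuotSection.charCocycle]
      · rw [← hc' g, ← hc g, ← Submodule.map_comp]; rfl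

variable (F) in
/-- Triples `(H, [τ'], [A])`: a subgroup `H` of `G`, a class `[τ'] ∈ H²_sym(H, F^×)`, and the class
of a central simple `G/H`-graded algebra `A` up to character twists. -/
def Triple (s : ∀ H : Subgroup G, QuotSection H) : Type _ :=
  Σ H : Subgroup G, SymCoh.H2sym H Fˣ × Quotient (charSetoid.{u, v, w} F (s H))

end

end GradedAlg

/-! The invariants are read off the centroid. If `B` is graded-simple, kernels and images of
homogeneous centroid elements are graded ideals, so a nonzero such element is invertible
(`bijective_of_mem_centroidComp`). If `B` is also graded-central, each homogeneous component of the
centroid has dimension at most one, the degrees that occur form a subgroup `H`, and generators `X h`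
satisfy `X h * X k = τ'(h, k) X (h * k)` for a symmetric cocycle `τ'` on `H`. Since the generators
are unique up to scalars, `H` and the class of `τ'` depend only on `B`.

For the loop algebra of a central simple `A`, the homogeneous centroid elements are the multiples of
the shifts `a ⊗ k ↦ a ⊗ hk` with `h ∈ H`, whose cocycle is trivial; twisting by `τ` turns it into
`τ` restricted to `H`. Hence an isomorphism of twisted loop algebras forces equal subgroups
(`subgroup_eq_of_twistedEquiv_loop`) and equal restricted classes (`exists_conj_loopShift`). As `ξ`
is a section, equal restricted classes give equal twists, which cancel. The remaining isomorphism of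
loop algebras commutes with the shifts up to a character `χ` of `H`, and evaluating it on the chosen
representatives identifies `A_χ` with the other algebra (`exists_charTwist_iso`). In the other
direction, `χ ∘ σ` inflated to `G` is a coboundary, so character twists are invisible on loop
algebras; this gives well-definedness (`iso_twistedLoop`).

For surjectivity, extend `τ'` to `G` up to a coboundary by means of `ξ` and untwist `B` by this
extension. The centroid elements then multiply like `H` itself, and identifying `x` with its
`H`-translates yields a `G/H`-graded algebra `A` whose loop algebra is the untwisted `B`
(`exists_loop_iso`). It is graded-simple with scalar centroid because ideals and centroid components
lift to the loop algebra (`isCentralSimple_of_loop`). A minimal-length argument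
(`exists_centroid_of_ideal`) upgrades graded-simple with scalar centroid to simple. -/

namespace GradedAlg

/-! ### Graded linear algebra, and isomorphisms up to a cocycle. -/

section

variable {F : Type u} [Field F] {G : Type v} [CommGroup G]

/-! ### Homogeneous components -/

open Classical in
/-- The linear map given by `f g` on `A_g`. -/
noncomputable def liftHom (A : GradedAlg.{u, v, w} F G) {M : Type*} [AddCommGroup M] [Module F M]
    (f : G → A.carrier →ₗ[F] M) : A.carrier →ₗ[F] M :=
  (DirectSum.toModule F G M fun g => f g ∘ₗ (A.comp g).subtype) ∘ₗ
    (A.decomp.symm : A.carrier →ₗ[F] _)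

theorem liftHom_of_mem (A : GradedAlg.{u, v, w} F G) {M : Type*} [AddCommGroup M] [Module F M]
    (f : G → A.carrier →ₗ[F] M) {g : G} {x : A.carrier} (hx : x ∈ A.comp g) :
    A.liftHom f x = f g x := by
  classical
  simp only [liftHom, LinearMap.comp_apply, LinearEquiv.coe_coe]
  rw [decomp_symm_of_mem A hx, DirectSum.toModule_lof]
  simp

/-- A subspace containing all homogeneous elements is everything. -/
theorem eq_top_of_comp_le (A : GradedAlg.{u, v, w} F G) {P : Submodule F A.carrier}
    (H : ∀ g, A.comp g ≤ P) : P = ⊤ :=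
  top_le_iff.1 (A.iSup_eq_top ▸ iSup_le H)

theorem hom_ext (A : GradedAlg.{u, v, w} F G) {M : Type*} [AddCommGroup M] [Module F M]
    {f f' : A.carrier →ₗ[F] M} (H : ∀ g, ∀ x ∈ A.comp g, f x = f' x) : f = f' :=
  LinearMap.eqLocus_eq_top.1 (A.eq_top_of_comp_le fun g x hx => H g x hx)

/-- The homogeneous components of an element, as a finitely supported function. -/
noncomputable def comps (A : GradedAlg.{u, v, w} F G) : A.carrier →ₗ[F] G →₀ A.carrier :=
  A.liftHom fun g => Finsupp.lsingle g

theorem comps_of_mem (A : GradedAlg.{u, v, w} F G) {g : G} {x : A.carrier} (hx : x ∈ A.comp g) :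
    A.comps x = Finsupp.single g x :=
  A.liftHom_of_mem _ hx

theorem comps_self (A : GradedAlg.{u, v, w} F G) {g : G} {x : A.carrier} (hx : x ∈ A.comp g) :
    A.comps x g = x := by
  rw [A.comps_of_mem hx, Finsupp.single_eq_same]

theorem comps_ne (A : GradedAlg.{u, v, w} F G) {g k : G} {x : A.carrier} (hx : x ∈ A.comp g)
    (hk : k ≠ g) : A.comps x k = 0 := by
  rw [A.comps_of_mem hx, Finsupp.single_eq_of_ne hk]

theorem comps_mem (A : GradedAlg.{u, v, w} F G) (x : A.carrier) (g : G) :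
    A.comps x g ∈ A.comp g := by
  have h := A.eq_top_of_comp_le (P := (A.comp g).comap (Finsupp.lapply g ∘ₗ A.comps))
    (fun k x hx => by
      simp only [Submodule.mem_comap, LinearMap.comp_apply, Finsupp.lapply_apply]
      by_cases hk : g = k
      · subst hk; rwa [A.comps_self hx]
      · rw [A.comps_ne hx hk]; exact zero_mem _)
  exact (h ▸ Submodule.mem_top : x ∈ (A.comp g).comap (Finsupp.lapply g ∘ₗ A.comps))

theorem sum_comps (A : GradedAlg.{u, v, w} F G) (x : A.carrier) :
    ((A.comps x).sum fun _ a => a) = x := by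
  have h : (Finsupp.lsum F fun _ : G => (LinearMap.id : A.carrier →ₗ[F] A.carrier)) ∘ₗ A.comps =
      LinearMap.id := A.hom_ext fun g x hx => by
    rw [LinearMap.comp_apply, A.comps_of_mem hx]; simp
  exact LinearMap.congr_fun h x

theorem comps_injective (A : GradedAlg.{u, v, w} F G) : Function.Injective A.comps :=
  fun x y h => by rw [← A.sum_comps x, ← A.sum_comps y, h]

/-- An element all of whose components other than the one of degree `g` vanish is homogeneous. -/
theorem mem_comp_of_comps_eq_zero (A : GradedAlg.{u, v, w} F G) {g : G} {x : A.carrier}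
    (h : ∀ k, k ≠ g → A.comps x k = 0) : x ∈ A.comp g := by
  rw [← A.sum_comps x]
  refine Submodule.sum_mem _ fun k hk => ?_
  by_cases hkg : k = g
  · subst hkg; exact A.comps_mem x k
  · exact absurd (h k hkg) (Finsupp.mem_support_iff.1 hk)

theorem eq_zero_of_mem_of_mem (A : GradedAlg.{u, v, w} F G) {g k : G} {x : A.carrier}
    (hx : x ∈ A.comp g) (hx' : x ∈ A.comp k) (hgk : g ≠ k) : x = 0 := by
  rw [← A.comps_self hx, A.comps_ne hx' hgk]

theorem mem_of_comps_mem (A : GradedAlg.{u, v, w} F G) {I : Submodule F A.carrier} {x : A.carrier}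
    (h : ∀ g, A.comps x g ∈ I) : x ∈ I := by
  rw [← A.sum_comps x]
  exact Submodule.sum_mem _ fun k _ => h k

/-- A linear map homogeneous of degree `z` shifts components. -/
theorem comps_apply_of_degree (A B : GradedAlg.{u, v, w} F G) (z : G)
    (f : A.carrier →ₗ[F] B.carrier) (hf : ∀ g, ∀ x ∈ A.comp g, f x ∈ B.comp (z * g))
    (x : A.carrier) (g : G) : B.comps (f x) (z * g) = f (A.comps x g) := by
  have h : Finsupp.lapply (z * g) ∘ₗ B.comps ∘ₗ f = f ∘ₗ Finsupp.lapply g ∘ₗ A.comps :=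
    A.hom_ext fun k x hx => by
      simp only [LinearMap.comp_apply, Finsupp.lapply_apply]
      by_cases hk : g = k
      · subst hk; rw [A.comps_self hx, B.comps_self (hf _ _ hx)]
      · rw [A.comps_ne hx hk, B.comps_ne (hf _ _ hx) (by simpa using hk), map_zero]
  exact LinearMap.congr_fun h x

/-- Components of a product with a homogeneous left factor. -/
theorem comps_mul_left (A : GradedAlg.{u, v, w} F G) {z : G} {b : A.carrier} (hb : b ∈ A.comp z)
    (x : A.carrier) (g : G) : A.comps (A.mul b x) (z * g) = A.mul b (A.comps x g) :=
  comps_apply_of_degree A A z (A.mul b) (fun k y hy => A.mul_mem z k b y hb hy) x g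

/-- Components of a product with a homogeneous right factor. -/
theorem comps_mul_right (A : GradedAlg.{u, v, w} F G) {z : G} {b : A.carrier} (hb : b ∈ A.comp z)
    (x : A.carrier) (g : G) : A.comps (A.mul x b) (z * g) = A.mul (A.comps x g) b :=
  comps_apply_of_degree A A z (A.mul.flip b)
    (fun k y hy => by rw [mul_comm]; exact A.mul_mem k z y b hy hb) x g

theorem exists_comp_ne_zero (A : GradedAlg.{u, v, w} F G) {I : Submodule F A.carrier}
    (h : ∀ x ∈ I, ∀ g, A.comps x g ∈ I) (hI : I ≠ ⊥) : ∃ g, ∃ x ∈ A.comp g, x ∈ I ∧ x ≠ 0 := by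
  obtain ⟨x, hx, hx0⟩ := Submodule.exists_mem_ne_zero_of_ne_bot hI
  by_contra! H
  refine hx0 (A.comps_injective ?_)
  ext g
  rw [map_zero]
  exact H g _ (A.comps_mem x g) (h x hx g)

/-! ### Criteria on homogeneous elements -/

theorem isIdeal_of_homogeneous (A : GradedAlg.{u, v, w} F G) {I : Submodule F A.carrier}
    (h : ∀ g, ∀ a ∈ A.comp g, ∀ x ∈ I, A.mul a x ∈ I ∧ A.mul x a ∈ I) :
    BilinAlg.IsIdeal A.mul I := by
  intro a x hx
  have h1 := A.eq_top_of_comp_le (P := I.comap (A.mul.flip x)) fun g a ha => (h g a ha x hx).1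
  have h2 := A.eq_top_of_comp_le (P := I.comap (A.mul x)) fun g a ha => (h g a ha x hx).2
  exact ⟨(h1 ▸ Submodule.mem_top : a ∈ I.comap (A.mul.flip x)),
    (h2 ▸ Submodule.mem_top : a ∈ I.comap (A.mul x))⟩

theorem isGradedIdeal_iff (A : GradedAlg.{u, v, w} F G) {I : Submodule F A.carrier} :
    A.IsGradedIdeal I ↔ BilinAlg.IsIdeal A.mul I ∧ ∀ x ∈ I, ∀ g, A.comps x g ∈ I := by
  refine and_congr_right fun _ => ⟨fun h x hx g => ?_, fun h => le_antisymm (fun x hx => ?_) ?_⟩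
  · rw [h] at hx
    refine Submodule.iSup_induction _ (motive := fun x => A.comps x g ∈ I) hx
      (fun k x hx => ?_) (by simp) (fun a b ha hb => by simpa using add_mem ha hb)
    by_cases hk : g = k
    · subst hk; rw [A.comps_self hx.2]; exact hx.1
    · rw [A.comps_ne hx.2 hk]; exact zero_mem _
  · rw [← A.sum_comps x]
    exact Submodule.sum_mem _ fun k _ =>
      Submodule.mem_iSup_of_mem k ⟨h x hx k, A.comps_mem x k⟩
  · exact iSup_le fun g => inf_le_left

theorem mem_centroid_of_homogeneous (A : GradedAlg.{u, v, w} F G) {c : Module.End F A.carrier}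
    (h : ∀ g k, ∀ x ∈ A.comp g, ∀ y ∈ A.comp k,
      c (A.mul x y) = A.mul (c x) y ∧ c (A.mul x y) = A.mul x (c y)) :
    c ∈ BilinAlg.centroid A.mul := by
  have h1 := A.bilin_ext (A.mul.compr₂ c) (A.mul.compl₁₂ c LinearMap.id)
    fun g k x hx y hy => (h g k x hx y hy).1
  have h2 := A.bilin_ext (A.mul.compr₂ c) (A.mul.compl₁₂ LinearMap.id c)
    fun g k x hx y hy => (h g k x hx y hy).2
  exact fun x y => ⟨LinearMap.congr_fun₂ h1 x y, LinearMap.congr_fun₂ h2 x y⟩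

/-- If `A² = A`, a subspace containing the products of homogeneous elements is everything. -/
theorem eq_top_of_mul_mem (A : GradedAlg.{u, v, w} F G) (hA : Submodule.map₂ A.mul ⊤ ⊤ = ⊤)
    {P : Submodule F A.carrier}
    (h : ∀ g k, ∀ x ∈ A.comp g, ∀ y ∈ A.comp k, A.mul x y ∈ P) : P = ⊤ := by
  have h0 := A.bilin_ext (A.mul.compr₂ P.mkQ) 0 fun g k x hx y hy => by
    simpa using h g k x hx y hy
  rw [eq_top_iff, ← hA, Submodule.map₂_le]
  intro x _ y _
  simpa using LinearMap.congr_fun₂ h0 x y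

/-- If `A² = A`, the centroid is commutative. -/
theorem centroid_comm {A : Type*} [AddCommGroup A] [Module F A] {m : A →ₗ[F] A →ₗ[F] A}
    (hA : Submodule.map₂ m ⊤ ⊤ = ⊤) {c c' : Module.End F A} (hc : c ∈ BilinAlg.centroid m)
    (hc' : c' ∈ BilinAlg.centroid m) : c * c' = c' * c := by
  refine LinearMap.eqLocus_eq_top.1 (top_le_iff.1 (hA ▸ Submodule.map₂_le.2 fun x _ y _ => ?_))
  change c (c' (m x y)) = c' (c (m x y))
  rw [(hc' x y).1, (hc _ _).2, (hc x y).2, (hc' _ _).1]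

/-! ### Annihilators and ideals of simple algebras -/

/-- The elements annihilated by all left and right multiplications. -/
def annihilator {A : Type*} [AddCommGroup A] [Module F A] (m : A →ₗ[F] A →ₗ[F] A) :
    Submodule F A := LinearMap.ker m ⊓ LinearMap.ker m.flip

theorem mem_annihilator {A : Type*} [AddCommGroup A] [Module F A] {m : A →ₗ[F] A →ₗ[F] A} {x : A} :
    x ∈ annihilator m ↔ ∀ y, m x y = 0 ∧ m y x = 0 := by
  simp only [annihilator, Submodule.mem_inf, LinearMap.mem_ker, LinearMap.ext_iff,
    LinearMap.flip_apply, LinearMap.zero_apply, forall_and]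

theorem isIdeal_annihilator {A : Type*} [AddCommGroup A] [Module F A]
    (m : A →ₗ[F] A →ₗ[F] A) : BilinAlg.IsIdeal m (annihilator m) := by
  intro a x hx
  rw [mem_annihilator] at hx
  rw [(hx a).1, (hx a).2]
  exact ⟨zero_mem _, zero_mem _⟩

theorem annihilator_ne_top {A : Type*} [AddCommGroup A] [Module F A] [Nontrivial A]
    {m : A →ₗ[F] A →ₗ[F] A} (hA : Submodule.map₂ m ⊤ ⊤ = ⊤) : annihilator m ≠ ⊤ := by
  intro h
  have h0 : Submodule.map₂ m ⊤ ⊤ ≤ (⊥ : Submodule F A) := Submodule.map₂_le.2 fun x _ y _ =>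
    (mem_annihilator.1 (h ▸ Submodule.mem_top : x ∈ annihilator m) y).1
  rw [hA, top_le_iff] at h0
  exact bot_ne_top h0

/-! ### Twisted isomorphisms -/

/-- A graded linear isomorphism `φ` from `A` to `B` with `φ(x)φ(y) = τ(g, h) φ(xy)` for `x ∈ A_g`
and `y ∈ A_h`. -/
structure TwistedEquiv (τ : SymCoh.Z2sym G Fˣ) (A B : GradedAlg.{u, v, w} F G) where
  toEquiv : A.carrier ≃ₗ[F] B.carrier
  map_mul : ∀ g h, ∀ x ∈ A.comp g, ∀ y ∈ A.comp h,
    B.mul (toEquiv x) (toEquiv y) = (τ.1 g h : F) • toEquiv (A.mul x y)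
  map_mem : ∀ g, ∀ x ∈ A.comp g, toEquiv x ∈ B.comp g
  symm_mem : ∀ g, ∀ x ∈ B.comp g, toEquiv.symm x ∈ A.comp g

theorem iso_twist_iff_nonempty (A B : GradedAlg.{u, v, w} F G) (τ : SymCoh.Z2sym G Fˣ) :
    Iso (A.twist τ) B ↔ Nonempty (TwistedEquiv τ A B) := by
  rw [iso_twist_iff]
  constructor
  · rintro ⟨φ, hm, hc⟩
    refine ⟨φ, fun g h x hx y hy => (hm g h x hx y hy).symm,
      fun g x hx => hc g ▸ Submodule.mem_map_of_mem hx, fun g x hx => ?_⟩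
    rw [← hc g] at hx
    obtain ⟨y, hy, rfl⟩ := hx
    simpa using hy
  · rintro ⟨φ, hm, h1, h2⟩
    refine ⟨φ, fun g h x hx y hy => (hm g h x hx y hy).symm, fun g => le_antisymm ?_ fun x hx =>
      ⟨φ.symm x, h2 g x hx, by simp⟩⟩
    rintro _ ⟨x, hx, rfl⟩
    exact h1 g x hx

namespace TwistedEquiv

variable {A B C : GradedAlg.{u, v, w} F G} {τ τ' : SymCoh.Z2sym G Fˣ}

/-- The inverse of a `τ`-twisted isomorphism. -/
def symm (φ : TwistedEquiv τ A B) : TwistedEquiv τ⁻¹ B A where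
  toEquiv := φ.toEquiv.symm
  map_mul g h x hx y hy := by
    have h1 := φ.map_mul g h _ (φ.symm_mem g x hx) _ (φ.symm_mem h y hy)
    simp only [LinearEquiv.apply_symm_apply] at h1
    rw [h1, map_smul, smul_smul, LinearEquiv.symm_apply_apply]
    simp
  map_mem := φ.symm_mem
  symm_mem g x hx := by simpa using φ.map_mem g x hx

/-- The composition of twisted isomorphisms. -/
def trans (φ : TwistedEquiv τ A B) (ψ : TwistedEquiv τ' B C) : TwistedEquiv (τ * τ') A C where
  toEquiv := φ.toEquiv.trans ψ.toEquiv
  map_mul g h x hx y hy := by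
    have h1 := ψ.map_mul g h _ (φ.map_mem g x hx) _ (φ.map_mem h y hy)
    rw [φ.map_mul g h x hx y hy, map_smul, smul_smul] at h1
    simpa [mul_comm] using h1
  map_mem g x hx := ψ.map_mem g _ (φ.map_mem g x hx)
  symm_mem g x hx := φ.symm_mem g _ (ψ.symm_mem g x hx)

/-- A twisted isomorphism for an equal cocycle. -/
def cast (φ : TwistedEquiv τ A B) (h : τ = τ') : TwistedEquiv τ' A B := h ▸ φ

theorem comps_apply (φ : TwistedEquiv τ A B) (x : A.carrier) (g : G) :
    B.comps (φ.toEquiv x) g = φ.toEquiv (A.comps x g) := by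
  have h := comps_apply_of_degree A B 1 (φ.toEquiv : A.carrier →ₗ[F] B.carrier)
    (fun g x hx => by rw [one_mul]; exact φ.map_mem g x hx) x g
  rwa [one_mul] at h

/-- On homogeneous factors the two products differ by a scalar, and a graded ideal can be tested on
components. Ungraded ideals need not be preserved, since the scalar varies with the degree. -/
theorem isGradedIdeal_map (φ : TwistedEquiv τ A B) {I : Submodule F A.carrier}
    (hI : A.IsGradedIdeal I) :
    B.IsGradedIdeal (I.map (φ.toEquiv : A.carrier →ₗ[F] B.carrier)) := by
  rw [isGradedIdeal_iff] at hI ⊢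
  have hI2 : ∀ x ∈ I.map (φ.toEquiv : A.carrier →ₗ[F] B.carrier), ∀ g,
      B.comps x g ∈ I.map (φ.toEquiv : A.carrier →ₗ[F] B.carrier) := by
    rintro _ ⟨x, hx, rfl⟩ g
    exact ⟨_, hI.2 x hx g, (φ.comps_apply x g).symm⟩
  refine ⟨B.isIdeal_of_homogeneous ?_, hI2⟩
  rintro g b hb _ ⟨x, hx, rfl⟩
  obtain ⟨a, rfl⟩ := φ.toEquiv.surjective b
  have ha : a ∈ A.comp g := by simpa using φ.symm_mem g _ hb
  constructor <;> refine B.mem_of_comps_mem fun k => ?_ <;>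
    obtain ⟨k, rfl⟩ : ∃ k', g * k' = k := ⟨g⁻¹ * k, by simp⟩
  · rw [B.comps_mul_left hb, LinearEquiv.coe_coe, φ.comps_apply,
      φ.map_mul g k a ha _ (A.comps_mem x k)]
    exact Submodule.smul_mem _ _ ⟨_, (hI.1 a _ (hI.2 x hx k)).1, rfl⟩
  · rw [B.comps_mul_right hb, LinearEquiv.coe_coe, φ.comps_apply,
      φ.map_mul k g _ (A.comps_mem x k) a ha]
    exact Submodule.smul_mem _ _ ⟨_, (hI.1 a _ (hI.2 x hx k)).2, rfl⟩

theorem isGradedSimple (φ : TwistedEquiv τ A B) (hA : A.IsGradedSimple) : B.IsGradedSimple := by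
  obtain ⟨h1, h2, h3⟩ := hA
  refine ⟨φ.toEquiv.symm.toEquiv.nontrivial, ?_, fun I hI => ?_⟩
  · have h := A.eq_top_of_mul_mem h2
      (P := (Submodule.map₂ B.mul ⊤ ⊤).comap (φ.toEquiv : A.carrier →ₗ[F] B.carrier))
      fun g k x hx y hy => by
        rw [Submodule.mem_comap, LinearEquiv.coe_coe,
          ← Submodule.smul_mem_iff _ (τ.1 g k).ne_zero, ← φ.map_mul g k x hx y hy]
        exact Submodule.apply_mem_map₂ _ trivial trivial
    rw [eq_top_iff]
    intro b _
    obtain ⟨a, rfl⟩ := φ.toEquiv.surjective b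
    have ha : a ∈ (⊤ : Submodule F A.carrier) := trivial
    rwa [← h] at ha
  · have e : I = (I.map (φ.symm.toEquiv : B.carrier →ₗ[F] A.carrier)).map
        (φ.toEquiv : A.carrier →ₗ[F] B.carrier) := by
      rw [← Submodule.map_comp]
      simp [symm]
    rcases h3 _ (φ.symm.isGradedIdeal_map hI) with h | h
    · left; rw [e, h, Submodule.map_bot]
    · right; rw [e, h]; simp

/-- The transport of homogeneous elements of degree `g` of the centroid along a twisted
isomorphism. -/
noncomputable def conj (φ : TwistedEquiv τ A B) (g : G) (c : Module.End F A.carrier) :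
    Module.End F B.carrier :=
  (φ.toEquiv : A.carrier →ₗ[F] B.carrier) ∘ₗ c ∘ₗ A.scale (fun k => (τ.1 g k : F)) ∘ₗ
    (φ.toEquiv.symm : B.carrier →ₗ[F] A.carrier)

theorem conj_apply (φ : TwistedEquiv τ A B) (g : G) (c : Module.End F A.carrier) {k : G}
    {x : A.carrier} (hx : x ∈ A.comp k) :
    φ.conj g c (φ.toEquiv x) = (τ.1 g k : F) • φ.toEquiv (c x) := by
  simp [conj, A.scale_of_mem _ hx]

/-- The scaling by `τ(g, k)` in `conj` is exactly what the cocycle identity requires: `τ(g, k) τ(gk,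
l) = τ(g, kl) τ(k, l)` gives compatibility with the left factor, and symmetry of `τ` gives the right
one. -/
theorem conj_mem (φ : TwistedEquiv τ A B) {g : G} {c : Module.End F A.carrier}
    (hc : c ∈ A.centroidComp g) : φ.conj g c ∈ B.centroidComp g := by
  refine ⟨B.mem_centroid_of_homogeneous fun k l x hx y hy => ?_, fun k x hx => ?_⟩
  · obtain ⟨x, rfl⟩ := φ.toEquiv.surjective x
    obtain ⟨y, rfl⟩ := φ.toEquiv.surjective y
    have hx' : x ∈ A.comp k := by simpa using φ.symm_mem _ _ hx
    have hy' : y ∈ A.comp l := by simpa using φ.symm_mem _ _ hy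
    rw [φ.map_mul k l x hx' y hy', map_smul, φ.conj_apply g c hx', φ.conj_apply g c hy',
      φ.conj_apply g c (A.mul_mem _ _ _ _ hx' hy'), map_smul, LinearMap.map_smul,
      LinearMap.smul_apply, φ.map_mul _ _ _ (hc.2 k x hx') _ hy',
      φ.map_mul _ _ _ hx' _ (hc.2 l y hy')]
    simp only [smul_smul, ← Units.val_mul]
    constructor
    · rw [(hc.1 x y).1, mul_comm, ← τ.2.1]
    · rw [(hc.1 x y).2, τ.2.2 k (g * l), mul_comm, τ.2.1, mul_comm k l, τ.2.2 k l]
  · obtain ⟨x, rfl⟩ := φ.toEquiv.surjective x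
    have hx' : x ∈ A.comp k := by simpa using φ.symm_mem _ _ hx
    rw [φ.conj_apply g c hx']
    exact Submodule.smul_mem _ _ (φ.map_mem _ _ (hc.2 k x hx'))

theorem conj_eq_zero (φ : TwistedEquiv τ A B) {g : G} {c : Module.End F A.carrier}
    (h : φ.conj g c = 0) : c = 0 := by
  refine A.hom_ext fun k x hx => ?_
  have h1 := φ.conj_apply g c hx
  rw [h, LinearMap.zero_apply] at h1
  simpa using h1.symm

theorem centroidComp_eq_bot_iff (φ : TwistedEquiv τ A B) (g : G) :
    A.centroidComp g = ⊥ ↔ B.centroidComp g = ⊥ := by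
  simp only [Submodule.eq_bot_iff]
  exact ⟨fun h c hc => φ.symm.conj_eq_zero (h _ (φ.symm.conj_mem hc)),
    fun h c hc => φ.conj_eq_zero (h _ (φ.conj_mem hc))⟩

end TwistedEquiv

/-- Cocycles are not assumed normalized; constancy in `g` is what makes `conj` in degree one send
scalars to scalars. -/
theorem cocycle_one_left (τ : SymCoh.Z2sym G Fˣ) (g : G) : τ.1 1 g = τ.1 1 1 := by
  have h := τ.2.1 1 1 g
  simp only [one_mul] at h
  exact (mul_right_cancel h).symm

theorem isGradedCentral_iff (A : GradedAlg.{u, v, w} F G) :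
    A.IsGradedCentral ↔ ∀ c ∈ A.centroidComp 1, ∃ r : F, ∀ x, c x = r • x := by
  constructor
  · intro h c hc
    rw [IsGradedCentral] at h
    rw [h, Submodule.mem_span_singleton] at hc
    obtain ⟨r, rfl⟩ := hc
    exact ⟨r, fun x => rfl⟩
  · intro h
    refine le_antisymm (fun c hc => ?_) ?_
    · obtain ⟨r, hr⟩ := h c hc
      exact Submodule.mem_span_singleton.2 ⟨r, LinearMap.ext fun x => (hr x).symm⟩
    · rw [Submodule.span_singleton_le_iff_mem]
      exact ⟨one_mem _, fun g x hx => by simpa using hx⟩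

theorem TwistedEquiv.isGradedCentralSimple {A B : GradedAlg.{u, v, w} F G}
    {τ : SymCoh.Z2sym G Fˣ} (φ : TwistedEquiv τ A B) (hA : A.IsGradedCentralSimple) :
    B.IsGradedCentralSimple := by
  refine ⟨φ.isGradedSimple hA.1, B.isGradedCentral_iff.2 fun c hc => ?_⟩
  obtain ⟨r, hr⟩ := A.isGradedCentral_iff.1 hA.2 _ (φ.symm.conj_mem hc)
  refine ⟨(τ.1 1 1 : F) * r, fun x => ?_⟩
  -- The transport of `c` to `A` is the scalar `r`; it was scaled by `τ(1, k)⁻¹`, which does not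
  -- depend on `k`.
  have h : c = ((τ.1 1 1 : F) * r) • LinearMap.id := B.hom_ext fun k x hx => by
    have h1 := φ.symm.conj_apply 1 c hx
    rw [hr, cocycle_one_left, ← map_smul, ← map_smul] at h1
    have h2 := φ.symm.toEquiv.injective h1
    rw [LinearMap.smul_apply, mul_smul, LinearMap.id_apply, h2, smul_smul]
    simp
  rw [h]; rfl

/-- The coboundary of `γ` as a symmetric cocycle. -/
def coboundary (γ : G → Fˣ) : SymCoh.Z2sym G Fˣ :=
  ⟨SymCoh.d G Fˣ γ, fun a b c => by
    simp only [SymCoh.d, MonoidHom.coe_mk, OneHom.coe_mk, mul_assoc a b c]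
    generalize γ (a * b) = e
    generalize γ (b * c) = f
    generalize γ (a * (b * c)) = k
    have h1 : γ a * γ b * e⁻¹ * (e * γ c * k⁻¹) = γ a * γ b * γ c * k⁻¹ * (e * e⁻¹) := by ac_rfl
    have h2 : γ a * f * k⁻¹ * (γ b * γ c * f⁻¹) = γ a * γ b * γ c * k⁻¹ * (f * f⁻¹) := by ac_rfl
    rw [h1, h2]; simp,
  fun a b => by
    simp only [SymCoh.d, MonoidHom.coe_mk, OneHom.coe_mk]
    rw [mul_comm (γ a), mul_comm a]⟩

theorem exists_coboundary_of_mk_eq {τ τ' : SymCoh.Z2sym G Fˣ}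
    (h : (QuotientGroup.mk τ : SymCoh.H2sym G Fˣ) = QuotientGroup.mk τ') :
    ∃ γ : G → Fˣ, τ * coboundary γ = τ' := by
  rw [QuotientGroup.eq] at h
  obtain ⟨γ, hγ⟩ := h
  refine ⟨γ, ?_⟩
  have : coboundary γ = τ⁻¹ * τ' := Subtype.ext hγ
  rw [this, mul_inv_cancel_left]

/-- Rescaling the components gives a twisted automorphism for a coboundary. -/
noncomputable def scaleEquiv (A : GradedAlg.{u, v, w} F G) (γ : G → Fˣ) :
    TwistedEquiv (coboundary γ) A A :=
  have h2 : ∀ (δ δ' : G → Fˣ), (∀ g, δ g * δ' g = 1) →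
      A.scale (fun g => (δ g : F)) ∘ₗ A.scale (fun g => (δ' g : F)) = LinearMap.id :=
    fun δ δ' hδ => A.hom_ext fun g x hx => by
      rw [LinearMap.comp_apply, A.scale_of_mem _ hx, map_smul, A.scale_of_mem _ hx, smul_smul,
        mul_comm, ← Units.val_mul, hδ]
      simp
  { toEquiv := LinearEquiv.ofLinearMap (A.scale fun g => (γ g : F))
      (A.scale fun g => ((γ g)⁻¹ : Fˣ)) (h2 _ _ fun g => by simp) (h2 _ _ fun g => by simp)
    map_mul g k x hx y hy := by
      change A.mul (A.scale (fun g => (γ g : F)) x) (A.scale (fun g => (γ g : F)) y) =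
        _ • A.scale (fun g => (γ g : F)) _
      rw [A.scale_of_mem _ hx, A.scale_of_mem _ hy, A.scale_of_mem _ (A.mul_mem _ _ _ _ hx hy),
        map_smul, LinearMap.map_smul, LinearMap.smul_apply, smul_smul, smul_smul]
      congr 1
      simp only [coboundary, SymCoh.d, MonoidHom.coe_mk, OneHom.coe_mk]
      push_cast
      field_simp
    map_mem g x hx := by
      change A.scale (fun g => (γ g : F)) x ∈ _
      rw [A.scale_of_mem _ hx]
      exact Submodule.smul_mem _ _ hx
    symm_mem g x hx := by
      change A.scale (fun g => ((γ g)⁻¹ : Fˣ)) x ∈ _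
      rw [A.scale_of_mem _ hx]
      exact Submodule.smul_mem _ _ hx }

/-- The identity as a twisted isomorphism onto the twist. -/
theorem nonempty_twistedEquiv_twist (A : GradedAlg.{u, v, w} F G) (τ : SymCoh.Z2sym G Fˣ) :
    Nonempty (TwistedEquiv τ A (A.twist τ)) :=
  (iso_twist_iff_nonempty A _ τ).1 (Iso.refl _)

/-- Only the quotient of the two cocycles matters, so comparisons of twisted loop algebras take
place between the untwisted ones. -/
theorem iso_twist_twist_iff (A B : GradedAlg.{u, v, w} F G) (τ τ' : SymCoh.Z2sym G Fˣ) :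
    Iso (A.twist τ) (B.twist τ') ↔ Nonempty (TwistedEquiv (τ * τ'⁻¹) A B) := by
  obtain ⟨ψ⟩ := nonempty_twistedEquiv_twist B τ'
  rw [iso_twist_iff_nonempty]
  exact ⟨fun ⟨φ⟩ => ⟨φ.trans ψ.symm⟩, fun ⟨φ⟩ => ⟨(φ.trans ψ).cast (by simp)⟩⟩

end

end GradedAlg

/-! ### Loop algebras of central simple algebras and their centroids. -/

namespace GradedAlg

section

variable {F : Type u} [Field F] {G : Type v} [CommGroup G] {H : Subgroup G}

/-! ### The loop algebra -/

/-- The linear map `a ↦ a_{π(k)} ⊗ k` into the loop algebra. -/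
noncomputable def toLoop (A : GradedAlg.{u, v, w} F (G ⧸ H)) (k : G) :
    A.carrier →ₗ[F] A.loop.carrier :=
  LinearMap.codRestrict A.loopSubmodule
    (Finsupp.lsingle k ∘ₗ Finsupp.lapply (QuotientGroup.mk k : G ⧸ H) ∘ₗ A.comps)
    fun a => A.single_mem_loop (A.comps_mem a _)

/-- The algebra homomorphism `a ⊗ k ↦ a` from the loop algebra. -/
noncomputable def ofLoop (A : GradedAlg.{u, v, w} F (G ⧸ H)) :
    A.loop.carrier →ₗ[F] A.carrier :=
  (Finsupp.lsum F fun _ : G => (LinearMap.id : A.carrier →ₗ[F] A.carrier)) ∘ₗ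
    A.loopSubmodule.subtype

theorem toLoop_mem (A : GradedAlg.{u, v, w} F (G ⧸ H)) (k : G) (a : A.carrier) :
    A.toLoop k a ∈ A.loop.comp k := fun l hl => by
  change Finsupp.single k (A.comps a (QuotientGroup.mk k)) l = 0
  exact Finsupp.single_eq_of_ne hl

theorem ofLoop_toLoop (A : GradedAlg.{u, v, w} F (G ⧸ H)) (k : G) (a : A.carrier) :
    A.ofLoop (A.toLoop k a) = A.comps a (QuotientGroup.mk k) := by
  change Finsupp.lsum F (fun _ : G => (LinearMap.id : A.carrier →ₗ[F] A.carrier))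
    (Finsupp.single k (A.comps a (QuotientGroup.mk k))) = _
  simp

theorem ofLoop_toLoop_of_mem (A : GradedAlg.{u, v, w} F (G ⧸ H)) {k : G} {a : A.carrier}
    (ha : a ∈ A.comp (QuotientGroup.mk k)) : A.ofLoop (A.toLoop k a) = a := by
  rw [ofLoop_toLoop, A.comps_self ha]

theorem ofLoop_mem (A : GradedAlg.{u, v, w} F (G ⧸ H)) {k : G} {x : A.loop.carrier}
    (hx : x ∈ A.loop.comp k) : A.ofLoop x ∈ A.comp (QuotientGroup.mk k) := by
  change Finsupp.lsum F (fun _ : G => (LinearMap.id : A.carrier →ₗ[F] A.carrier)) x.1 ∈ _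
  rw [A.loopComp_eq_single hx]
  simpa using x.2 k

theorem toLoop_ofLoop (A : GradedAlg.{u, v, w} F (G ⧸ H)) {k : G} {x : A.loop.carrier}
    (hx : x ∈ A.loop.comp k) : A.toLoop k (A.ofLoop x) = x := by
  refine Subtype.ext ?_
  change Finsupp.single k (A.comps (A.ofLoop x) (QuotientGroup.mk k)) = x.1
  rw [A.comps_self (A.ofLoop_mem hx)]
  change Finsupp.single k
    (Finsupp.lsum F (fun _ : G => (LinearMap.id : A.carrier →ₗ[F] A.carrier)) x.1) = x.1
  rw [A.loopComp_eq_single hx]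
  simp

theorem toLoop_eq_zero_of_ne (A : GradedAlg.{u, v, w} F (G ⧸ H)) {k : G} {z : G ⧸ H}
    {a : A.carrier}
    (ha : a ∈ A.comp z) (hz : QuotientGroup.mk k ≠ z) : A.toLoop k a = 0 := by
  rw [← A.toLoop_ofLoop (A.toLoop_mem k a), ofLoop_toLoop, A.comps_ne ha hz, map_zero]

theorem loop_mul_toLoop (A : GradedAlg.{u, v, w} F (G ⧸ H)) {k l : G} {a b : A.carrier}
    (ha : a ∈ A.comp (QuotientGroup.mk k)) (hb : b ∈ A.comp (QuotientGroup.mk l)) :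
    A.loop.mul (A.toLoop k a) (A.toLoop l b) = A.toLoop (k * l) (A.mul a b) := by
  refine Subtype.ext ?_
  change groupAlgMul A.mul (Finsupp.single k (A.comps a (QuotientGroup.mk k)))
    (Finsupp.single l (A.comps b (QuotientGroup.mk l))) =
    Finsupp.single (k * l) (A.comps (A.mul a b) (QuotientGroup.mk (k * l)))
  rw [A.comps_self ha, A.comps_self hb, QuotientGroup.mk_mul, A.comps_self (A.mul_mem _ _ _ _ ha hb),
    groupAlgMul_single]

/-- Only `b` has to be homogeneous: `toLoop l` selects the component of degree `π(l)`, and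
multiplication by `b` carries precisely that component into degree `π(kl)`. -/
theorem toLoop_mul_left (A : GradedAlg.{u, v, w} F (G ⧸ H)) {k : G} (l : G) {b : A.carrier}
    (hb : b ∈ A.comp (QuotientGroup.mk k)) (a : A.carrier) :
    A.toLoop (k * l) (A.mul b a) = A.loop.mul (A.toLoop k b) (A.toLoop l a) := by
  have h : A.toLoop (k * l) ∘ₗ A.mul b = A.loop.mul (A.toLoop k b) ∘ₗ A.toLoop l :=
    A.hom_ext fun z a ha => by
      simp only [LinearMap.comp_apply]
      by_cases hz : QuotientGroup.mk l = z
      · subst hz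
        rw [A.loop_mul_toLoop hb ha]
      · rw [A.toLoop_eq_zero_of_ne ha hz, map_zero,
          A.toLoop_eq_zero_of_ne (A.mul_mem _ _ _ _ hb ha)]
        rw [QuotientGroup.mk_mul]
        exact fun e => hz (mul_left_cancel e)
  exact LinearMap.congr_fun h a

theorem toLoop_mul_right (A : GradedAlg.{u, v, w} F (G ⧸ H)) {k : G} (l : G) {b : A.carrier}
    (hb : b ∈ A.comp (QuotientGroup.mk k)) (a : A.carrier) :
    A.toLoop (l * k) (A.mul a b) = A.loop.mul (A.toLoop l a) (A.toLoop k b) := by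
  have h : A.toLoop (l * k) ∘ₗ A.mul.flip b = A.loop.mul.flip (A.toLoop k b) ∘ₗ A.toLoop l :=
    A.hom_ext fun z a ha => by
      simp only [LinearMap.comp_apply, LinearMap.flip_apply]
      by_cases hz : QuotientGroup.mk l = z
      · subst hz
        rw [A.loop_mul_toLoop ha hb]
      · rw [A.toLoop_eq_zero_of_ne ha hz, map_zero, LinearMap.zero_apply,
          A.toLoop_eq_zero_of_ne (A.mul_mem _ _ _ _ ha hb)]
        rw [QuotientGroup.mk_mul]
        exact fun e => hz (mul_right_cancel e)
  exact LinearMap.congr_fun h a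

theorem ofLoop_mul (A : GradedAlg.{u, v, w} F (G ⧸ H)) (x y : A.loop.carrier) :
    A.ofLoop (A.loop.mul x y) = A.mul (A.ofLoop x) (A.ofLoop y) := by
  have h := A.loop.bilin_ext (A.loop.mul.compr₂ A.ofLoop) (A.mul.compl₁₂ A.ofLoop A.ofLoop)
    fun k l x hx y hy => by
      simp only [LinearMap.compr₂_apply, LinearMap.compl₁₂_apply]
      rw [← A.toLoop_ofLoop hx, ← A.toLoop_ofLoop hy,
        A.loop_mul_toLoop (A.ofLoop_mem hx) (A.ofLoop_mem hy),
        A.ofLoop_toLoop_of_mem (A.mul_mem _ _ _ _ (A.ofLoop_mem hx) (A.ofLoop_mem hy)),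
        A.ofLoop_toLoop_of_mem (A.ofLoop_mem hx), A.ofLoop_toLoop_of_mem (A.ofLoop_mem hy)]
  exact LinearMap.congr_fun₂ h x y

/-! ### Loop algebras of central simple algebras are graded-central-simple -/

theorem centroid_eq_bot_iff {A : Type*} [AddCommGroup A] [Module F A] {m : A →ₗ[F] A →ₗ[F] A} :
    BilinAlg.centroid m = ⊥ ↔ ∀ c ∈ BilinAlg.centroid m, ∃ r : F, ∀ x, c x = r • x := by
  rw [eq_bot_iff]
  refine forall₂_congr fun c _ => ?_
  rw [Algebra.mem_bot]
  refine exists_congr fun r => ?_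
  rw [LinearMap.ext_iff]
  exact forall_congr' fun x => eq_comm

theorem map₂_loop_eq_top (A : GradedAlg.{u, v, w} F (G ⧸ H))
    (hA : Submodule.map₂ A.mul ⊤ ⊤ = ⊤) : Submodule.map₂ A.loop.mul ⊤ ⊤ = ⊤ := by
  refine A.loop.eq_top_of_comp_le fun k x hx => ?_
  have h := A.eq_top_of_mul_mem hA
    (P := (Submodule.map₂ A.loop.mul ⊤ ⊤).comap (A.toLoop k)) fun y z b hb d hd => by
      obtain ⟨l, rfl⟩ := QuotientGroup.mk_surjective y
      rw [Submodule.mem_comap]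
      obtain ⟨k, rfl⟩ : ∃ k', l * k' = k := ⟨l⁻¹ * k, by simp⟩
      rw [A.toLoop_mul_left k hb]
      exact Submodule.apply_mem_map₂ _ trivial trivial
  have hx' : A.ofLoop x ∈ (⊤ : Submodule F A.carrier) := trivial
  rw [← h, Submodule.mem_comap, A.toLoop_ofLoop hx] at hx'
  exact hx'

/-- A nonzero graded ideal `I` yields the ideal `J` of those `a` all of whose lifts to the loop
algebra lie in `I`. For a homogeneous `x ∈ I` lying over `a`, every lift of `ab` is `x` times a lift
of `b`, so `ab` and `ba` lie in `J`. If `J = 0`, then `a` annihilates `A`, which is impossible for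
`a ≠ 0`; otherwise `J = A` and `I` is everything. -/
theorem isGradedSimple_loop (A : GradedAlg.{u, v, w} F (G ⧸ H)) (hA : BilinAlg.IsSimple A.mul) :
    A.loop.IsGradedSimple := by
  obtain ⟨hn, h2, h3⟩ := hA
  have hann : annihilator A.mul = ⊥ :=
    (h3 _ (isIdeal_annihilator _)).resolve_right (annihilator_ne_top h2)
  refine ⟨?_, A.map₂_loop_eq_top h2, fun I hI => or_iff_not_imp_left.2 fun hI0 => ?_⟩
  · obtain ⟨z, a, ha, -, ha0⟩ := A.exists_comp_ne_zero (I := ⊤) (by simp) top_ne_bot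
    obtain ⟨k, rfl⟩ := QuotientGroup.mk_surjective z
    refine ⟨A.toLoop k a, 0, fun h => ha0 ?_⟩
    rw [← A.ofLoop_toLoop_of_mem ha, h, map_zero]
  rw [isGradedIdeal_iff] at hI
  let J : Submodule F A.carrier := ⨅ k, I.comap (A.toLoop k)
  have hJ : ∀ a, a ∈ J ↔ ∀ k, A.toLoop k a ∈ I := fun a => by simp [J]
  have hJid : BilinAlg.IsIdeal A.mul J := A.isIdeal_of_homogeneous fun z b hb a ha => by
    obtain ⟨l, rfl⟩ := QuotientGroup.mk_surjective z
    rw [hJ] at ha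
    constructor
    · refine (hJ _).2 fun k => ?_
      obtain ⟨k, rfl⟩ : ∃ k', l * k' = k := ⟨l⁻¹ * k, by simp⟩
      rw [A.toLoop_mul_left k hb]
      exact (hI.1 _ _ (ha k)).1
    · refine (hJ _).2 fun k => ?_
      obtain ⟨k, rfl⟩ : ∃ k', k' * l = k := ⟨k * l⁻¹, by simp⟩
      rw [A.toLoop_mul_right k hb]
      exact (hI.1 _ _ (ha k)).2
  obtain ⟨l, x, hx, hxI, hx0⟩ := A.loop.exists_comp_ne_zero hI.2 hI0
  have ha := A.ofLoop_mem hx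
  have ha0 : A.ofLoop x ≠ 0 := fun h => hx0 (by rw [← A.toLoop_ofLoop hx, h, map_zero])
  have hkey : ∀ z, ∀ b ∈ A.comp z, A.mul (A.ofLoop x) b ∈ J ∧ A.mul b (A.ofLoop x) ∈ J := by
    intro z b hb
    obtain ⟨m, rfl⟩ := QuotientGroup.mk_surjective z
    constructor
    · refine (hJ _).2 fun k => ?_
      obtain ⟨k, rfl⟩ : ∃ k', l * k' = k := ⟨l⁻¹ * k, by simp⟩
      rw [A.toLoop_mul_left k ha, A.toLoop_ofLoop hx]
      exact (hI.1 _ _ hxI).2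
    · refine (hJ _).2 fun k => ?_
      obtain ⟨k, rfl⟩ : ∃ k', k' * l = k := ⟨k * l⁻¹, by simp⟩
      rw [A.toLoop_mul_right k ha, A.toLoop_ofLoop hx]
      exact (hI.1 _ _ hxI).1
  rcases h3 J hJid with h | h
  · refine absurd ?_ ha0
    rw [h] at hkey
    rw [← Submodule.mem_bot F, ← hann]
    exact ⟨A.hom_ext fun z b hb => (hkey z b hb).1, A.hom_ext fun z b hb => (hkey z b hb).2⟩
  · refine A.loop.eq_top_of_comp_le fun k y hy => ?_
    rw [← A.toLoop_ofLoop hy]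
    exact (hJ _).1 (h ▸ Submodule.mem_top) k

/-- The elements of the centroid of the loop algebra of a central simple algebra act as scalars
after forgetting the degree. -/
theorem exists_smul_of_mem_centroid_loop (A : GradedAlg.{u, v, w} F (G ⧸ H))
    (hA : A.IsCentralSimple) {c : Module.End F A.loop.carrier}
    (hc : c ∈ BilinAlg.centroid A.loop.mul) :
    ∃ r : F, ∀ x, A.ofLoop (c x) = r • A.ofLoop x := by
  -- Since `A² = A`, it suffices to test on products `bd`. The centroid element can be moved onto
  -- the lift of `b`, chosen once for both sides, and the lifts of `d` in degrees congruent modulo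
  -- `H` have the same image in `A`.
  have hindep : ∀ k l : G, (QuotientGroup.mk k : G ⧸ H) = QuotientGroup.mk l →
      A.ofLoop ∘ₗ c ∘ₗ A.toLoop k = A.ofLoop ∘ₗ c ∘ₗ A.toLoop l := by
    intro k l hkl
    refine LinearMap.eqLocus_eq_top.1 (A.eq_top_of_mul_mem hA.1.2.1 fun y z b hb d hd => ?_)
    obtain ⟨m, rfl⟩ := QuotientGroup.mk_surjective y
    obtain ⟨k, rfl⟩ : ∃ k', m * k' = k := ⟨m⁻¹ * k, by simp⟩
    obtain ⟨l, rfl⟩ : ∃ k', m * k' = l := ⟨m⁻¹ * l, by simp⟩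
    rw [QuotientGroup.mk_mul, QuotientGroup.mk_mul] at hkl
    change A.ofLoop (c (A.toLoop (m * k) (A.mul b d))) = A.ofLoop (c (A.toLoop (m * l) (A.mul b d)))
    rw [A.toLoop_mul_left k hb, A.toLoop_mul_left l hb, (hc _ _).1, (hc _ _).1, A.ofLoop_mul,
      A.ofLoop_mul, A.ofLoop_toLoop, A.ofLoop_toLoop, mul_left_cancel hkl]
  let c' : Module.End F A.carrier := A.liftHom fun z => A.ofLoop ∘ₗ c ∘ₗ A.toLoop (Quotient.out z)
  have hc' : ∀ k : G, ∀ a ∈ A.comp (QuotientGroup.mk k), c' a = A.ofLoop (c (A.toLoop k a)) := by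
    intro k a ha
    rw [A.liftHom_of_mem _ ha]
    exact LinearMap.congr_fun (hindep _ _ (Quotient.out_eq _)) a
  have hmem : c' ∈ BilinAlg.centroid A.mul := A.mem_centroid_of_homogeneous fun y z a ha b hb => by
    obtain ⟨k, rfl⟩ := QuotientGroup.mk_surjective y
    obtain ⟨l, rfl⟩ := QuotientGroup.mk_surjective z
    rw [hc' k a ha, hc' l b hb, hc' (k * l) _ (A.mul_mem _ _ _ _ ha hb),
      ← A.loop_mul_toLoop ha hb]
    constructor
    · rw [(hc _ _).1, A.ofLoop_mul, A.ofLoop_toLoop_of_mem hb]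
    · rw [(hc _ _).2, A.ofLoop_mul, A.ofLoop_toLoop_of_mem ha]
  obtain ⟨r, hr⟩ := centroid_eq_bot_iff.1 hA.2 c' hmem
  refine ⟨r, fun x => ?_⟩
  have h : A.ofLoop ∘ₗ c = r • A.ofLoop := A.loop.hom_ext fun k x hx => by
    rw [LinearMap.comp_apply, LinearMap.smul_apply, ← hr, hc' k _ (A.ofLoop_mem hx),
      A.toLoop_ofLoop hx]
  exact LinearMap.congr_fun h x

/-- The shift `a ⊗ k ↦ f(a) ⊗ gk` of the loop algebra, for `f` homogeneous of degree `π(g)`. -/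
noncomputable def loopShift (A : GradedAlg.{u, v, w} F (G ⧸ H)) (g : G)
    (f : Module.End F A.carrier) : Module.End F A.loop.carrier :=
  A.loop.liftHom fun k => A.toLoop (g * k) ∘ₗ f ∘ₗ A.ofLoop

theorem loopShift_of_mem (A : GradedAlg.{u, v, w} F (G ⧸ H)) (g : G) (f : Module.End F A.carrier)
    {k : G} {x : A.loop.carrier} (hx : x ∈ A.loop.comp k) :
    A.loopShift g f x = A.toLoop (g * k) (f (A.ofLoop x)) :=
  A.loop.liftHom_of_mem _ hx

theorem loopShift_mem_centroidComp (A : GradedAlg.{u, v, w} F (G ⧸ H)) {g : G}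
    {f : Module.End F A.carrier} (hf : f ∈ A.centroidComp (QuotientGroup.mk g)) :
    A.loopShift g f ∈ A.loop.centroidComp g := by
  have hmem : ∀ k, ∀ x ∈ A.loop.comp k, f (A.ofLoop x) ∈ A.comp (QuotientGroup.mk (g * k)) :=
    fun k x hx => hf.2 _ _ (A.ofLoop_mem hx)
  refine ⟨A.loop.mem_centroid_of_homogeneous fun k l x hx y hy => ?_, fun k x hx => ?_⟩
  · rw [A.loopShift_of_mem g f (A.loop.mul_mem _ _ _ _ hx hy), A.loopShift_of_mem g f hx,
      A.loopShift_of_mem g f hy, A.ofLoop_mul]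
    constructor
    · rw [← A.toLoop_ofLoop hy, A.loop_mul_toLoop (hmem k x hx) (A.ofLoop_mem hy),
        A.toLoop_ofLoop hy, (hf.1 _ _).1, mul_assoc]
    · rw [← A.toLoop_ofLoop hx, A.loop_mul_toLoop (A.ofLoop_mem hx) (hmem l y hy),
        A.toLoop_ofLoop hx, (hf.1 _ _).2, mul_left_comm]
  · rw [A.loopShift_of_mem g f hx]
    exact A.toLoop_mem _ _

theorem loopShift_eq_zero (A : GradedAlg.{u, v, w} F (G ⧸ H)) {g : G}
    {f : Module.End F A.carrier} (hf : f ∈ A.centroidComp (QuotientGroup.mk g))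
    (h : A.loopShift g f = 0) : f = 0 := by
  refine A.hom_ext fun z a ha => ?_
  obtain ⟨k, rfl⟩ := QuotientGroup.mk_surjective z
  have h1 := A.loopShift_of_mem g f (A.toLoop_mem k a)
  rw [h, A.ofLoop_toLoop_of_mem ha] at h1
  rw [← A.ofLoop_toLoop_of_mem (k := g * k) (hf.2 _ _ ha), ← h1]
  simp

theorem one_mem_centroidComp (A : GradedAlg.{u, v, w} F G) : 1 ∈ A.centroidComp 1 :=
  ⟨one_mem _, fun g x hx => by simpa using hx⟩

/-- Through `loopShift`, the identity of `A` viewed in degree `π(h) = 1` becomes the shift by `h`, a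
centroid element of degree `h`. -/
theorem one_mem_centroidComp_mk (A : GradedAlg.{u, v, w} F (G ⧸ H)) (h : H) :
    1 ∈ A.centroidComp (QuotientGroup.mk (h : G)) := by
  rw [(QuotientGroup.eq_one_iff _).2 h.2]
  exact A.one_mem_centroidComp

/-- After forgetting the `G`-degree, `c` acts as a scalar and so preserves the degree in `G/H`. It
also moves that degree by `π(g) ≠ 1`, so it vanishes. -/
theorem centroidComp_loop_of_notMem (A : GradedAlg.{u, v, w} F (G ⧸ H))
    (hA : A.IsCentralSimple) {g : G} (hg : g ∉ H) : A.loop.centroidComp g = ⊥ := by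
  rw [Submodule.eq_bot_iff]
  intro c hc
  obtain ⟨r, hr⟩ := A.exists_smul_of_mem_centroid_loop hA hc.1
  refine A.loop.hom_ext fun k x hx => ?_
  rw [← A.toLoop_ofLoop (hc.2 k x hx)]
  have h0 : A.ofLoop (c x) = 0 := by
    refine A.eq_zero_of_mem_of_mem (A.ofLoop_mem (hc.2 k x hx))
      (k := QuotientGroup.mk k) ?_ ?_
    · rw [hr]; exact Submodule.smul_mem _ _ (A.ofLoop_mem hx)
    · rw [QuotientGroup.mk_mul, Ne, mul_eq_right, QuotientGroup.eq_one_iff]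
      exact hg
  rw [h0, map_zero, LinearMap.zero_apply]

theorem exists_smul_loopShift (A : GradedAlg.{u, v, w} F (G ⧸ H)) (hA : A.IsCentralSimple)
    {g : G} {c : Module.End F A.loop.carrier} (hc : c ∈ A.loop.centroidComp g) :
    ∃ r : F, c = r • A.loopShift g 1 := by
  obtain ⟨r, hr⟩ := A.exists_smul_of_mem_centroid_loop hA hc.1
  refine ⟨r, A.loop.hom_ext fun k x hx => ?_⟩
  rw [LinearMap.smul_apply, A.loopShift_of_mem g 1 hx, Module.End.one_apply, ← map_smul, ← hr,
    A.toLoop_ofLoop (hc.2 k x hx)]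

theorem loopShift_ne_zero (A : GradedAlg.{u, v, w} F (G ⧸ H)) [Nontrivial A.carrier] (h : H) :
    A.loopShift (h : G) 1 ≠ 0 :=
  fun h0 => one_ne_zero (A.loopShift_eq_zero (A.one_mem_centroidComp_mk h) h0)

/-- Recovers `H` from the loop algebra as the support of its centroid. -/
theorem centroidComp_loop_eq_bot_iff (A : GradedAlg.{u, v, w} F (G ⧸ H))
    (hA : A.IsCentralSimple) (g : G) : A.loop.centroidComp g = ⊥ ↔ g ∉ H := by
  refine ⟨fun h hg => ?_, A.centroidComp_loop_of_notMem hA⟩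
  have := hA.1.1
  have h1 := A.loopShift_mem_centroidComp (A.one_mem_centroidComp_mk ⟨g, hg⟩)
  exact A.loopShift_ne_zero ⟨g, hg⟩ ((Submodule.mem_bot F).1 (h ▸ h1))

theorem isGradedCentralSimple_loop (A : GradedAlg.{u, v, w} F (G ⧸ H))
    (hA : A.IsCentralSimple) : A.loop.IsGradedCentralSimple := by
  refine ⟨A.isGradedSimple_loop hA.1, A.loop.isGradedCentral_iff.2 fun c hc => ?_⟩
  obtain ⟨r, rfl⟩ := A.exists_smul_loopShift hA hc
  have h : A.loopShift 1 1 = 1 := A.loop.hom_ext fun k x hx => by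
    rw [A.loopShift_of_mem 1 1 hx, one_mul, Module.End.one_apply, A.toLoop_ofLoop hx,
      Module.End.one_apply]
  exact ⟨r, fun x => by rw [h]; rfl⟩

theorem isGradedCentralSimple_twistedLoop (A : GradedAlg.{u, v, w} F (G ⧸ H))
    (hA : A.IsCentralSimple) (τ : SymCoh.Z2sym G Fˣ) :
    (A.twistedLoop τ).IsGradedCentralSimple := by
  obtain ⟨φ⟩ := nonempty_twistedEquiv_twist A.loop τ
  exact φ.isGradedCentralSimple (A.isGradedCentralSimple_loop hA)

end

end GradedAlg

/-! ### Well-definedness on classes, and what an isomorphism of loop algebras determines. -/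

namespace GradedAlg

section

variable {F : Type u} [Field F] {G : Type v} [CommGroup G] {H : Subgroup G}

/-! ### Loop algebras of twists -/

/-- The map of loop algebras induced by a linear map. -/
noncomputable def loopMap {A B : GradedAlg.{u, v, w} F (G ⧸ H)}
    (f : A.carrier →ₗ[F] B.carrier) : A.loop.carrier →ₗ[F] B.loop.carrier :=
  A.loop.liftHom fun k => B.toLoop k ∘ₗ f ∘ₗ A.ofLoop

theorem loopMap_of_mem {A B : GradedAlg.{u, v, w} F (G ⧸ H)} (f : A.carrier →ₗ[F] B.carrier)
    {k : G} {x : A.loop.carrier} (hx : x ∈ A.loop.comp k) :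
    loopMap f x = B.toLoop k (f (A.ofLoop x)) :=
  A.loop.liftHom_of_mem _ hx

theorem loopMap_comp_loopMap {A B : GradedAlg.{u, v, w} F (G ⧸ H)}
    {f : A.carrier →ₗ[F] B.carrier} {f' : B.carrier →ₗ[F] A.carrier}
    (hf : ∀ z, ∀ a ∈ A.comp z, f a ∈ B.comp z) (h : ∀ a, f' (f a) = a) :
    loopMap f' ∘ₗ loopMap f = LinearMap.id :=
  A.loop.hom_ext fun k x hx => by
    rw [LinearMap.comp_apply, loopMap_of_mem f hx, loopMap_of_mem f' (B.toLoop_mem _ _),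
      B.ofLoop_toLoop_of_mem (hf _ _ (A.ofLoop_mem hx)), h, A.toLoop_ofLoop hx,
      LinearMap.id_apply]

/-- A twisted isomorphism of `G/H`-graded algebras induces one of the loop algebras. -/
noncomputable def TwistedEquiv.loop {A B : GradedAlg.{u, v, w} F (G ⧸ H)}
    {τ : SymCoh.Z2sym (G ⧸ H) Fˣ} (φ : TwistedEquiv τ A B) :
    TwistedEquiv (SymCoh.Z2sym.pullback Fˣ (QuotientGroup.mk' H) τ) A.loop B.loop where
  toEquiv := LinearEquiv.ofLinearMap (loopMap (φ.toEquiv : A.carrier →ₗ[F] B.carrier))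
    (loopMap (φ.toEquiv.symm : B.carrier →ₗ[F] A.carrier))
    (loopMap_comp_loopMap φ.symm_mem (by simp)) (loopMap_comp_loopMap φ.map_mem (by simp))
  map_mul k l x hx y hy := by
    change B.loop.mul (loopMap (φ.toEquiv : A.carrier →ₗ[F] B.carrier) x)
      (loopMap (φ.toEquiv : A.carrier →ₗ[F] B.carrier) y) =
      ((τ.1 (QuotientGroup.mk k) (QuotientGroup.mk l) : Fˣ) : F) •
        loopMap (φ.toEquiv : A.carrier →ₗ[F] B.carrier) (A.loop.mul x y)
    have hx' := A.ofLoop_mem hx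
    have hy' := A.ofLoop_mem hy
    rw [loopMap_of_mem _ hx, loopMap_of_mem _ hy, loopMap_of_mem _ (A.loop.mul_mem _ _ _ _ hx hy),
      A.ofLoop_mul, LinearEquiv.coe_coe, B.loop_mul_toLoop (φ.map_mem _ _ hx') (φ.map_mem _ _ hy'),
      φ.map_mul _ _ _ hx' _ hy', map_smul]
  map_mem k x hx := by
    change loopMap (φ.toEquiv : A.carrier →ₗ[F] B.carrier) x ∈ _
    rw [loopMap_of_mem _ hx]
    exact B.toLoop_mem _ _
  symm_mem k x hx := by
    change loopMap (φ.toEquiv.symm : B.carrier →ₗ[F] A.carrier) x ∈ _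
    rw [loopMap_of_mem _ hx]
    exact A.toLoop_mem _ _

/-- The function `g ↦ s(π(g)) g⁻¹` takes values in `H`, and its coboundary is the inflation of `σ`;
apply `χ`. -/
theorem exists_pullback_charCocycle_eq (s : QuotSection H) (χ : H →* Fˣ) :
    ∃ γ : G → Fˣ,
      SymCoh.Z2sym.pullback Fˣ (QuotientGroup.mk' H) (s.charCocycle χ) = coboundary γ := by
  have hmem : ∀ g : G, s.1 (QuotientGroup.mk g) * g⁻¹ ∈ H := fun g => by
    rw [← QuotientGroup.eq_one_iff, QuotientGroup.mk_mul, s.2, QuotientGroup.mk_inv,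
      mul_inv_cancel]
  refine ⟨fun g => χ ⟨_, hmem g⟩, Subtype.ext ?_⟩
  funext a b
  change χ (s.sigma (QuotientGroup.mk a) (QuotientGroup.mk b)) =
    χ ⟨_, hmem a⟩ * χ ⟨_, hmem b⟩ * (χ ⟨_, hmem (a * b)⟩)⁻¹
  rw [← map_mul, ← map_inv, ← map_mul]
  congr 1
  ext
  simp only [QuotSection.sigma, Subgroup.coe_mul, Subgroup.coe_inv, QuotientGroup.mk_mul]
  generalize s.1 (QuotientGroup.mk a * QuotientGroup.mk b) = e
  rw [mul_inv, inv_inv]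
  generalize s.1 (QuotientGroup.mk a) = c
  generalize s.1 (QuotientGroup.mk b) = d
  have : c * a⁻¹ * (d * b⁻¹) * (e⁻¹ * (a * b)) = c * d * e⁻¹ * (a⁻¹ * a) * (b⁻¹ * b) := by ac_rfl
  rw [this]; simp

/-- Twisting by a character does not change the loop algebra. -/
theorem nonempty_twistedEquiv_loop_of_charTwist {A B : GradedAlg.{u, v, w} F (G ⧸ H)}
    {s : QuotSection H} {χ : H →* Fˣ} (h : Iso (A.charTwist s χ) B) :
    Nonempty (TwistedEquiv 1 A.loop B.loop) := by
  obtain ⟨φ⟩ := (iso_twist_iff_nonempty A B _).1 h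
  obtain ⟨γ, hγ⟩ := exists_pullback_charCocycle_eq s χ
  exact ⟨((A.loop.scaleEquiv γ).symm.trans φ.loop).cast (by rw [hγ, inv_mul_cancel])⟩

/-! ### Isomorphic loop algebras -/

theorem subgroup_eq_of_twistedEquiv_loop {H H' : Subgroup G} {A : GradedAlg.{u, v, w} F (G ⧸ H)}
    {B : GradedAlg.{u, v, w} F (G ⧸ H')} (hA : A.IsCentralSimple) (hB : B.IsCentralSimple)
    {τ : SymCoh.Z2sym G Fˣ} (φ : TwistedEquiv τ A.loop B.loop) : H = H' := by
  ext g
  have h := φ.centroidComp_eq_bot_iff g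
  rwa [A.centroidComp_loop_eq_bot_iff hA, B.centroidComp_loop_eq_bot_iff hB, not_iff_not] at h

/-- Shifts by `H` change only the group label, which `ofLoop` forgets. -/
theorem ofLoop_loopShift (A : GradedAlg.{u, v, w} F (G ⧸ H)) (h : H) (x : A.loop.carrier) :
    A.ofLoop (A.loopShift (h : G) 1 x) = A.ofLoop x := by
  have e : A.ofLoop ∘ₗ A.loopShift (h : G) 1 = A.ofLoop := A.loop.hom_ext fun k x hx => by
    rw [LinearMap.comp_apply, A.loopShift_of_mem _ _ hx, Module.End.one_apply]
    refine A.ofLoop_toLoop_of_mem ?_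
    have := (A.one_mem_centroidComp_mk h).2 _ _ (A.ofLoop_mem hx)
    rwa [← QuotientGroup.mk_mul] at this
  exact LinearMap.congr_fun e x

theorem loopShift_mem (A : GradedAlg.{u, v, w} F (G ⧸ H)) (g : G) {k : G} {x : A.loop.carrier}
    (hx : x ∈ A.loop.comp k) : A.loopShift g 1 x ∈ A.loop.comp (g * k) := by
  rw [A.loopShift_of_mem _ _ hx]
  exact A.toLoop_mem _ _

theorem loopShift_mul (A : GradedAlg.{u, v, w} F (G ⧸ H)) (h h' : H) (x : A.loop.carrier) :
    A.loopShift (h : G) 1 (A.loopShift (h' : G) 1 x) = A.loopShift ((h * h' : H) : G) 1 x := by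
  have e : A.loopShift (h : G) 1 ∘ₗ A.loopShift (h' : G) 1 = A.loopShift ((h * h' : H) : G) 1 :=
    A.loop.hom_ext fun k x hx => by
      rw [LinearMap.comp_apply, A.loopShift_of_mem _ _ (A.loopShift_mem _ hx), A.ofLoop_loopShift,
        A.loopShift_of_mem _ _ hx, Subgroup.coe_mul, mul_assoc]
  exact LinearMap.congr_fun e x

theorem loopShift_injective (A : GradedAlg.{u, v, w} F (G ⧸ H)) (h : H) {k : G}
    {x : A.loop.carrier} (hx : x ∈ A.loop.comp k) (h0 : A.loopShift (h : G) 1 x = 0) : x = 0 := by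
  rw [← A.toLoop_ofLoop hx, ← A.ofLoop_loopShift h, h0, map_zero, map_zero]

/-- A twisted isomorphism of loop algebras commutes with the shifts by elements of `H` up to
scalars. -/
theorem exists_conj_loopShift {A B : GradedAlg.{u, v, w} F (G ⧸ H)} (hA : A.IsCentralSimple)
    (hB : B.IsCentralSimple) {τ : SymCoh.Z2sym G Fˣ} (φ : TwistedEquiv τ A.loop B.loop) :
    ∃ γ : H → Fˣ, (∀ (h : H) (k : G), ∀ x ∈ A.loop.comp k,
      (τ.1 h k : F) • φ.toEquiv (A.loopShift (h : G) 1 x) =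
        (γ h : F) • B.loopShift (h : G) 1 (φ.toEquiv x)) ∧
      SymCoh.Z2sym.pullback Fˣ H.subtype τ = coboundary γ := by
  have := hA.1.1
  -- Both the transported shift and the shift of `B` lie in the component of degree `h` of the
  -- centroid, which has dimension one.
  have hex : ∀ h : H, ∃ r : Fˣ,
      φ.conj (h : G) (A.loopShift (h : G) 1) = (r : F) • B.loopShift (h : G) 1 := fun h => by
    have hmem := A.loopShift_mem_centroidComp (A.one_mem_centroidComp_mk h)
    obtain ⟨r, hr⟩ := B.exists_smul_loopShift hB (φ.conj_mem hmem)
    have hr0 : r ≠ 0 := by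
      rintro rfl
      rw [zero_smul] at hr
      exact A.loopShift_ne_zero h (φ.conj_eq_zero hr)
    exact ⟨Units.mk0 r hr0, hr⟩
  choose γ hγ using hex
  have key : ∀ (h : H) (k : G), ∀ x ∈ A.loop.comp k,
      (τ.1 h k : F) • φ.toEquiv (A.loopShift (h : G) 1 x) =
        (γ h : F) • B.loopShift (h : G) 1 (φ.toEquiv x) := fun h k x hx => by
    rw [← φ.conj_apply _ _ hx, hγ, LinearMap.smul_apply]
  refine ⟨γ, key, Subtype.ext ?_⟩
  have hn := (A.isGradedSimple_loop hA.1).1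
  obtain ⟨k, x, hx, -, hx0⟩ := A.loop.exists_comp_ne_zero (I := ⊤) (by simp) top_ne_bot
  funext h h'
  change τ.1 h h' = γ h * γ h' * (γ (h * h'))⁻¹
  rw [eq_mul_inv_iff_mul_eq]
  set y := B.loopShift ((h * h' : H) : G) 1 (φ.toEquiv x) with hy
  have hy0 : y ≠ 0 := fun h0 => hx0 (φ.toEquiv.map_eq_zero_iff.1
    (B.loopShift_injective (h * h') (φ.map_mem k x hx) h0))
  have e1 := key (h * h') k x hx
  have e2 := key h (h' * k) _ (A.loopShift_mem h' hx)
  have e3 := key h' k x hx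
  rw [A.loopShift_mul] at e2
  -- Shifting by `h'` and then by `h`, compared with the single shift by `hh'`: the cocycle identity
  -- turns the discrepancy into `τ(h, h')`.
  have e4 : ((τ.1 h' k : F) * (τ.1 h (h' * k) : F)) •
      φ.toEquiv (A.loopShift ((h * h' : H) : G) 1 x) = ((γ h : F) * (γ h' : F)) • y := by
    rw [mul_smul, e2, smul_comm, ← map_smul, e3, map_smul, B.loopShift_mul, mul_smul]
  have e5 : ((γ h : F) * (γ h' : F)) • y = ((τ.1 h h' : F) * (γ (h * h') : F)) • y := by
    rw [← e4, mul_smul (τ.1 h h' : F), hy, ← e1, smul_smul]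
    congr 1
    rw [← Units.val_mul, ← Units.val_mul, mul_comm, ← τ.2.1, Subgroup.coe_mul]
  have e6 := smul_left_injective F hy0 e5
  rw [← Units.val_mul, ← Units.val_mul] at e6
  exact (Units.ext e6).symm

/-- If the loop algebras are isomorphic, the algebras agree up to a character twist. -/
theorem exists_charTwist_iso {A B : GradedAlg.{u, v, w} F (G ⧸ H)} (hA : A.IsCentralSimple)
    (hB : B.IsCentralSimple) (s : QuotSection H) (φ : TwistedEquiv 1 A.loop B.loop) :
    ∃ χ : H →* Fˣ, Iso (A.charTwist s χ) B := by
  obtain ⟨γ, hγ, hτ⟩ := exists_conj_loopShift hA hB φ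
  -- The cocycle is trivial here, so the coboundary of `γ` is `1`, which makes `γ` a character.
  have hmul : ∀ h h' : H, γ (h * h') = γ h * γ h' := fun h h' => by
    have e : (1 : Fˣ) = γ h * γ h' * (γ (h * h'))⁻¹ :=
      congrFun (congrFun (congrArg Subtype.val hτ) h) h'
    rw [eq_mul_inv_iff_mul_eq, one_mul] at e
    exact e
  have hγ' : ∀ (h : H) (k : G), ∀ x ∈ A.loop.comp k,
      φ.toEquiv (A.loopShift (h : G) 1 x) = (γ h : F) • B.loopShift (h : G) 1 (φ.toEquiv x) :=
    fun h k x hx => by simpa using hγ h k x hx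
  let χ : H →* Fˣ := MonoidHom.mk' γ hmul
  refine ⟨χ, (iso_twist_iff_nonempty A B _).2 ?_⟩
  have hs : ∀ {A : GradedAlg.{u, v, w} F (G ⧸ H)} {z : G ⧸ H} {a : A.carrier}, a ∈ A.comp z →
      a ∈ A.comp (QuotientGroup.mk (s.1 z)) := fun ha => by rwa [s.2]
  -- The isomorphism sought lifts degree `z` to the representative `s z`, applies `φ` and forgets
  -- the lift. Stated for general `A`, `B` and `τ` so that it also covers `φ.symm`.
  have hinv : ∀ {A B : GradedAlg.{u, v, w} F (G ⧸ H)} {τ : SymCoh.Z2sym G Fˣ}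
      (φ : TwistedEquiv τ A.loop B.loop),
      (B.liftHom fun z => A.ofLoop ∘ₗ (φ.toEquiv.symm : B.loop.carrier →ₗ[F] A.loop.carrier) ∘ₗ
        B.toLoop (s.1 z)) ∘ₗ
      (A.liftHom fun z => B.ofLoop ∘ₗ (φ.toEquiv : A.loop.carrier →ₗ[F] B.loop.carrier) ∘ₗ
        A.toLoop (s.1 z)) = LinearMap.id := by
    intro A B τ φ
    refine A.hom_ext fun z a ha => ?_
    have h1 := φ.map_mem _ _ (A.toLoop_mem (s.1 z) a)
    have h2 := B.ofLoop_mem h1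
    rw [s.2] at h2
    rw [LinearMap.comp_apply, A.liftHom_of_mem _ ha]
    simp only [LinearMap.comp_apply, LinearEquiv.coe_coe]
    rw [B.liftHom_of_mem _ h2]
    simp only [LinearMap.comp_apply, LinearEquiv.coe_coe]
    rw [B.toLoop_ofLoop h1, LinearEquiv.symm_apply_apply, A.ofLoop_toLoop_of_mem (hs ha),
      LinearMap.id_apply]
  have hmem : ∀ {A B : GradedAlg.{u, v, w} F (G ⧸ H)} {τ : SymCoh.Z2sym G Fˣ}
      (φ : TwistedEquiv τ A.loop B.loop), ∀ z, ∀ a ∈ A.comp z,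
      (A.liftHom fun z => B.ofLoop ∘ₗ (φ.toEquiv : A.loop.carrier →ₗ[F] B.loop.carrier) ∘ₗ
        A.toLoop (s.1 z)) a ∈ B.comp z := by
    intro A B τ φ z a ha
    rw [A.liftHom_of_mem _ ha]
    have h2 := B.ofLoop_mem (φ.map_mem _ _ (A.toLoop_mem (s.1 z) a))
    rwa [s.2] at h2
  refine ⟨LinearEquiv.ofLinearMap
      (A.liftHom fun z => B.ofLoop ∘ₗ (φ.toEquiv : A.loop.carrier →ₗ[F] B.loop.carrier) ∘ₗ
        A.toLoop (s.1 z))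
      (B.liftHom fun z => A.ofLoop ∘ₗ (φ.toEquiv.symm : B.loop.carrier →ₗ[F] A.loop.carrier) ∘ₗ
        B.toLoop (s.1 z)) (hinv φ.symm) (hinv φ), fun y z a ha b hb => ?_, hmem φ, hmem φ.symm⟩
  change B.mul (A.liftHom (fun z => B.ofLoop ∘ₗ
      (φ.toEquiv : A.loop.carrier →ₗ[F] B.loop.carrier) ∘ₗ A.toLoop (s.1 z)) a)
    (A.liftHom (fun z => B.ofLoop ∘ₗ
      (φ.toEquiv : A.loop.carrier →ₗ[F] B.loop.carrier) ∘ₗ A.toLoop (s.1 z)) b) =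
    (γ (s.sigma y z) : F) • A.liftHom (fun z => B.ofLoop ∘ₗ
      (φ.toEquiv : A.loop.carrier →ₗ[F] B.loop.carrier) ∘ₗ A.toLoop (s.1 z)) (A.mul a b)
  have hab := A.mul_mem _ _ _ _ ha hb
  rw [A.liftHom_of_mem _ ha, A.liftHom_of_mem _ hb, A.liftHom_of_mem _ hab]
  simp only [LinearMap.comp_apply, LinearEquiv.coe_coe]
  have hm := φ.map_mul _ _ _ (A.toLoop_mem (s.1 y) a) _ (A.toLoop_mem (s.1 z) b)
  -- The product of the lifts has degree `s(y) s(z) = σ(y, z) s(yz)`, so it is a shift by `σ(y, z)`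
  -- of the lift used for degree `yz`; this produces the factor `χ(σ(y, z))`.
  have hsh : A.toLoop (s.1 y * s.1 z) (A.mul a b) =
      A.loopShift (s.sigma y z : G) 1 (A.toLoop (s.1 (y * z)) (A.mul a b)) := by
    rw [A.loopShift_of_mem _ _ (A.toLoop_mem _ _), A.ofLoop_toLoop_of_mem (hs hab),
      Module.End.one_apply]
    simp [QuotSection.sigma]
  rw [← B.ofLoop_mul, hm, A.loop_mul_toLoop (hs ha) (hs hb), hsh,
    hγ' _ _ _ (A.toLoop_mem _ _), map_smul, map_smul, B.ofLoop_loopShift]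
  simp

end

end GradedAlg

/-! ### Descent from graded simplicity to central simplicity. -/

namespace GradedAlg

section

variable {F : Type u} [Field F] {G : Type v} [CommGroup G]

/-! ### Simplicity of graded-simple algebras with trivial centroid -/

/-- The homogeneous component of degree `z` of a linear endomorphism. -/
noncomputable def homComp (A : GradedAlg.{u, v, w} F G) (c : Module.End F A.carrier) (z : G) :
    Module.End F A.carrier :=
  A.liftHom fun y => Finsupp.lapply (z * y) ∘ₗ A.comps ∘ₗ c

theorem homComp_of_mem (A : GradedAlg.{u, v, w} F G) (c : Module.End F A.carrier) (z : G) {y : G}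
    {x : A.carrier} (hx : x ∈ A.comp y) : A.homComp c z x = A.comps (c x) (z * y) :=
  A.liftHom_of_mem _ hx

theorem homComp_mem_centroidComp (A : GradedAlg.{u, v, w} F G) {c : Module.End F A.carrier}
    (hc : c ∈ BilinAlg.centroid A.mul) (z : G) : A.homComp c z ∈ A.centroidComp z := by
  refine ⟨A.mem_centroid_of_homogeneous fun g k x hx y hy => ?_, fun g x hx => ?_⟩
  · rw [A.homComp_of_mem c z hx, A.homComp_of_mem c z hy,
      A.homComp_of_mem c z (A.mul_mem _ _ _ _ hx hy)]
    constructor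
    · rw [(hc _ _).1, ← A.comps_mul_right hy, mul_comm k, mul_assoc]
    · rw [(hc _ _).2, ← A.comps_mul_left hx, mul_left_comm]
  · rw [A.homComp_of_mem c z hx]
    exact A.comps_mem _ _

/-- An element of minimal length in a nonzero ideal of a graded-simple algebra yields an element
of the centroid with values in the ideal. -/
theorem exists_centroid_of_ideal (A : GradedAlg.{u, v, w} F G) (hA : A.IsGradedSimple)
    {J : Submodule F A.carrier} (hJ : BilinAlg.IsIdeal A.mul J) (hJ0 : J ≠ ⊥) :
    ∃ T ∈ BilinAlg.centroid A.mul, T ≠ 0 ∧ ∀ x, T x ∈ J := by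
  classical
  obtain ⟨a, ⟨haJ, ha0⟩, hmin⟩ : ∃ a, (a ∈ J ∧ a ≠ 0) ∧ ∀ u, u ∈ J ∧ u ≠ 0 →
      (A.comps a).support.card ≤ (A.comps u).support.card := by
    obtain ⟨b, hb⟩ := Submodule.exists_mem_ne_zero_of_ne_bot hJ0
    let f : A.carrier → ℕ := fun u => (A.comps u).support.card
    let S : Set A.carrier := {u | u ∈ J ∧ u ≠ 0}
    exact ⟨Function.argminOn f S ⟨b, hb⟩, Function.argminOn_mem f S ⟨b, hb⟩,
      fun u hu => Function.argminOn_le f S hu⟩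
  obtain ⟨x₀, hx₀⟩ : ∃ x₀, A.comps a x₀ ≠ 0 := by
    by_contra! h
    exact ha0 (A.comps_injective (by ext g; rw [h g, map_zero]; rfl))
  -- the elements of `J` whose support lies in the translate by `t` of the support of `a`
  let U : G → Submodule F A.carrier := fun t => J ⊓
    ⨅ z, ⨅ (_ : A.comps a z = 0), LinearMap.ker (Finsupp.lapply (t * z) ∘ₗ A.comps)
  have hU : ∀ t u, u ∈ U t ↔ u ∈ J ∧ ∀ z, A.comps a z = 0 → A.comps u (t * z) = 0 :=
    fun t u => by simp [U, Submodule.mem_iInf]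
  -- Losing the coordinate `t * x₀` would make the support smaller than that of `a`, contradicting
  -- minimality. So an element of `U t` is determined by this one coordinate.
  have huniq : ∀ t, ∀ u ∈ U t, A.comps u (t * x₀) = 0 → u = 0 := by
    intro t u hu h0
    rw [hU] at hu
    by_contra hne
    have hsub : (A.comps u).support ⊆ ((A.comps a).support.erase x₀).image (t * ·) := by
      intro y hy
      rw [Finsupp.mem_support_iff] at hy
      refine Finset.mem_image.2 ⟨t⁻¹ * y, Finset.mem_erase.2 ⟨?_, ?_⟩, by simp⟩
      · rintro rfl
        exact hy (by simpa using h0)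
      · rw [Finsupp.mem_support_iff]
        intro h
        exact hy (by simpa using hu.2 _ h)
    have h1 := (Finset.card_le_card hsub).trans Finset.card_image_le
    rw [Finset.card_erase_of_mem (Finsupp.mem_support_iff.2 hx₀)] at h1
    have h2 := hmin u ⟨hu.1, hne⟩
    have h3 : 0 < (A.comps a).support.card :=
      Finset.card_pos.2 ⟨x₀, Finsupp.mem_support_iff.2 hx₀⟩
    omega
  have hUl : ∀ t g, ∀ u ∈ U t, ∀ b ∈ A.comp g, A.mul b u ∈ U (g * t) := by
    intro t g u hu b hb
    rw [hU] at hu ⊢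
    refine ⟨(hJ b u hu.1).1, fun z hz => ?_⟩
    rw [mul_assoc, A.comps_mul_left hb, hu.2 z hz, map_zero]
  have hUr : ∀ t g, ∀ u ∈ U t, ∀ b ∈ A.comp g, A.mul u b ∈ U (g * t) := by
    intro t g u hu b hb
    rw [hU] at hu ⊢
    refine ⟨(hJ b u hu.1).2, fun z hz => ?_⟩
    rw [mul_assoc, A.comps_mul_right hb, hu.2 z hz, map_zero, LinearMap.zero_apply]
  let ev : ∀ t, A.carrier →ₗ[F] A.carrier := fun t => Finsupp.lapply (t * x₀) ∘ₗ A.comps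
  let N : G → Submodule F A.carrier := fun t => (U t).map (ev t)
  have hNmem : ∀ t, N t ≤ A.comp (t * x₀) := by
    rintro t _ ⟨u, -, rfl⟩
    exact A.comps_mem u _
  have hNcomps : ∀ x ∈ ⨆ t, N t, ∀ t, A.comps x (t * x₀) ∈ N t := by
    intro x hx t
    refine Submodule.iSup_induction N (motive := fun x => A.comps x (t * x₀) ∈ N t) hx
      (fun r x hx => ?_) (by simp) (fun b d hb hd => by simpa using add_mem hb hd)
    by_cases hr : t = r
    · subst hr; rwa [A.comps_self (hNmem t hx)]
    · rw [A.comps_ne (hNmem r hx) (by simpa using hr)]; exact zero_mem _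
  -- The distinguished coordinates span a graded ideal, nonzero because of `a`, hence everything:
  -- each homogeneous `b` is the distinguished coordinate of exactly one element of the
  -- corresponding `U t`.
  have hNideal : A.IsGradedIdeal (⨆ t, N t) := by
    rw [isGradedIdeal_iff]
    refine ⟨A.isIdeal_of_homogeneous fun g b hb x hx => ?_, fun x hx g => ?_⟩
    · constructor
      · refine Submodule.iSup_induction N (motive := fun x => A.mul b x ∈ ⨆ t, N t) hx
          ?_ (by simp) (fun b d hb hd => by simpa using add_mem hb hd)
        rintro t _ ⟨u, hu, rfl⟩
        refine Submodule.mem_iSup_of_mem (g * t) ⟨_, hUl t g u hu b hb, ?_⟩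
        change A.comps _ _ = A.mul b (A.comps u _)
        rw [mul_assoc, A.comps_mul_left hb]
      · refine Submodule.iSup_induction N (motive := fun x => A.mul x b ∈ ⨆ t, N t) hx
          ?_ (by simp) (fun b d hb hd => by simpa using add_mem hb hd)
        rintro t _ ⟨u, hu, rfl⟩
        refine Submodule.mem_iSup_of_mem (g * t) ⟨_, hUr t g u hu b hb, ?_⟩
        change A.comps _ _ = A.mul (A.comps u _) b
        rw [mul_assoc, A.comps_mul_right hb]
    · have h := hNcomps x hx (g * x₀⁻¹)
      rw [inv_mul_cancel_right] at h
      exact Submodule.mem_iSup_of_mem _ h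
  have haU : a ∈ U 1 := (hU 1 a).2 ⟨haJ, fun z hz => by rwa [one_mul]⟩
  have hNtop : ⨆ t, N t = ⊤ := by
    refine (hA.2.2 _ hNideal).resolve_left fun h => hx₀ ?_
    have h1 : ev 1 a ∈ ⨆ t, N t := Submodule.mem_iSup_of_mem 1 ⟨a, haU, rfl⟩
    rw [h, Submodule.mem_bot] at h1
    simpa [ev] using h1
  let e : ∀ t, U t ≃ₗ[F] A.comp (t * x₀) := fun t => LinearEquiv.ofBijective
    (LinearMap.codRestrict (A.comp (t * x₀)) (ev t ∘ₗ (U t).subtype) fun u => A.comps_mem _ _) (by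
      refine ⟨(injective_iff_map_eq_zero _).2 fun u hu => Subtype.ext (huniq t u u.2 ?_), ?_⟩
      · exact congrArg Subtype.val hu
      · rintro ⟨b, hb⟩
        have h := hNcomps b (hNtop ▸ Submodule.mem_top) t
        rw [A.comps_self hb] at h
        obtain ⟨u, hu, rfl⟩ := h
        exact ⟨⟨u, hu⟩, rfl⟩)
  -- `T b` is that unique element; for `b` of degree `y` the translate is `t = y x₀⁻¹`. Uniqueness
  -- forces `T` to commute with all multiplications.
  let T : Module.End F A.carrier := A.liftHom fun y => (U (y * x₀⁻¹)).subtype ∘ₗ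
    ((e (y * x₀⁻¹)).symm : _ →ₗ[F] _) ∘ₗ
      LinearMap.codRestrict (A.comp (y * x₀⁻¹ * x₀)) (ev (y * x₀⁻¹)) fun u => A.comps_mem _ _
  have hTU : ∀ y, ∀ b ∈ A.comp y, T b ∈ U (y * x₀⁻¹) := fun y b hb => by
    rw [A.liftHom_of_mem _ hb]
    exact Subtype.prop _
  have hTev : ∀ y, ∀ b ∈ A.comp y, A.comps (T b) y = b := fun y b hb => by
    have h : A.comps (T b) (y * x₀⁻¹ * x₀) = A.comps b (y * x₀⁻¹ * x₀) := by
      rw [A.liftHom_of_mem _ hb]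
      exact congrArg Subtype.val ((e (y * x₀⁻¹)).apply_symm_apply
        (LinearMap.codRestrict (A.comp (y * x₀⁻¹ * x₀)) (ev (y * x₀⁻¹))
          (fun u => A.comps_mem _ _) b))
    rw [inv_mul_cancel_right, A.comps_self hb] at h
    exact h
  have hTuniq : ∀ y, ∀ b ∈ A.comp y, ∀ u ∈ U (y * x₀⁻¹), A.comps u y = b → T b = u := by
    intro y b hb u hu hub
    refine sub_eq_zero.1 (huniq _ _ (sub_mem (hTU y b hb) hu) ?_)
    rw [inv_mul_cancel_right, map_sub, Finsupp.sub_apply, hTev y b hb, hub, sub_self]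
  refine ⟨T, A.mem_centroid_of_homogeneous fun g k x hx y hy => ⟨?_, ?_⟩, fun h => hx₀ ?_,
    fun x => ?_⟩
  · refine hTuniq _ _ (A.mul_mem _ _ _ _ hx hy) _ ?_ ?_
    · rw [mul_comm g k, mul_assoc]
      exact hUr _ _ _ (hTU g x hx) _ hy
    · rw [mul_comm g k, A.comps_mul_right hy, hTev g x hx]
  · refine hTuniq _ _ (A.mul_mem _ _ _ _ hx hy) _ ?_ ?_
    · rw [mul_assoc]
      exact hUl _ _ _ (hTU k y hy) _ hx
    · rw [A.comps_mul_left hx, hTev k y hy]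
  · rw [← hTev _ _ (A.comps_mem a x₀), h]
    simp
  · have h := A.eq_top_of_comp_le (P := J.comap T) fun y b hb => ((hU _ _).1 (hTU y b hb)).1
    exact (h ▸ Submodule.mem_top : x ∈ J.comap T)

/-- A graded-simple algebra whose centroid consists of the scalars is central simple. -/
theorem isCentralSimple_of_isGradedSimple (A : GradedAlg.{u, v, w} F G) (hA : A.IsGradedSimple)
    (hc : ∀ c ∈ BilinAlg.centroid A.mul, ∃ r : F, ∀ x, c x = r • x) : A.IsCentralSimple := by
  refine ⟨⟨hA.1, hA.2.1, fun J hJ => or_iff_not_imp_left.2 fun hJ0 => ?_⟩,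
    centroid_eq_bot_iff.2 hc⟩
  obtain ⟨T, hT, hT0, hTJ⟩ := A.exists_centroid_of_ideal hA hJ hJ0
  obtain ⟨r, hr⟩ := hc T hT
  have hr0 : r ≠ 0 := by
    rintro rfl
    exact hT0 (LinearMap.ext fun x => by simp [hr])
  refine (Submodule.eq_top_iff' ).2 fun x => ?_
  rw [← Submodule.smul_mem_iff _ hr0, ← hr]
  exact hTJ x

/-! ### Algebras with graded-central-simple loop algebra -/

variable {H : Subgroup G}

theorem isGradedSimple_of_loop (A : GradedAlg.{u, v, w} F (G ⧸ H)) (hA : A.loop.IsGradedSimple) :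
    A.IsGradedSimple := by
  obtain ⟨h1, h2, h3⟩ := hA
  have hsurj : Function.Surjective A.ofLoop := LinearMap.range_eq_top.1 <|
    A.eq_top_of_comp_le fun z a ha => by
      obtain ⟨k, rfl⟩ := QuotientGroup.mk_surjective z
      exact ⟨_, A.ofLoop_toLoop_of_mem ha⟩
  refine ⟨?_, ?_, fun J hJ => ?_⟩
  · obtain ⟨k, x, hx, -, hx0⟩ := A.loop.exists_comp_ne_zero (I := ⊤) (by simp) top_ne_bot
    refine ⟨A.ofLoop x, 0, fun h => hx0 ?_⟩
    rw [← A.toLoop_ofLoop hx, h, map_zero]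
  · have h := A.loop.eq_top_of_mul_mem h2
      (P := (Submodule.map₂ A.mul ⊤ ⊤).comap A.ofLoop) fun g k x _ y _ => by
        rw [Submodule.mem_comap, A.ofLoop_mul]
        exact Submodule.apply_mem_map₂ _ trivial trivial
    refine (Submodule.eq_top_iff').2 fun a => ?_
    obtain ⟨x, rfl⟩ := hsurj a
    exact (h ▸ Submodule.mem_top : x ∈ (Submodule.map₂ A.mul ⊤ ⊤).comap A.ofLoop)
  · rw [isGradedIdeal_iff] at hJ
    -- `I` is the preimage of `J` taken component by component, so that it is graded for `G` and not
    -- only for `G/H`.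
    let I : Submodule F A.loop.carrier :=
      ⨅ k : G, J.comap (A.ofLoop ∘ₗ Finsupp.lapply k ∘ₗ A.loop.comps)
    have hI : ∀ x, x ∈ I ↔ ∀ k, A.ofLoop (A.loop.comps x k) ∈ J := fun x => by
      simp [I, Submodule.mem_iInf]
    have hIhom : ∀ k, ∀ x ∈ A.loop.comp k, x ∈ I ↔ A.ofLoop x ∈ J := fun k x hx => by
      rw [hI]
      refine ⟨fun h => ?_, fun h l => ?_⟩
      · rw [← A.loop.comps_self hx]
        exact h k
      · by_cases hl : l = k
        · subst hl; rwa [A.loop.comps_self hx]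
        · rw [A.loop.comps_ne hx hl, map_zero]; exact zero_mem _
    have hIid : A.loop.IsGradedIdeal I := by
      rw [isGradedIdeal_iff]
      refine ⟨A.loop.isIdeal_of_homogeneous fun g b hb x hx => ?_, fun x hx k =>
        (hIhom k _ (A.loop.comps_mem x k)).2 ((hI x).1 hx k)⟩
      rw [hI] at hx
      constructor <;> refine (hI _).2 fun k => ?_ <;>
        obtain ⟨k, rfl⟩ : ∃ k', g * k' = k := ⟨g⁻¹ * k, by simp⟩
      · rw [A.loop.comps_mul_left hb, A.ofLoop_mul]
        exact (hJ.1 _ _ (hx k)).1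
      · rw [A.loop.comps_mul_right hb, A.ofLoop_mul]
        exact (hJ.1 _ _ (hx k)).2
    rcases h3 I hIid with h | h
    · left
      by_contra hJ0
      obtain ⟨z, a, ha, haJ, ha0⟩ := A.exists_comp_ne_zero hJ.2 hJ0
      obtain ⟨k, rfl⟩ := QuotientGroup.mk_surjective z
      have h4 : A.toLoop k a ∈ I := (hIhom k _ (A.toLoop_mem k a)).2 (by
        rwa [A.ofLoop_toLoop_of_mem ha])
      rw [h, Submodule.mem_bot] at h4
      exact ha0 (by rw [← A.ofLoop_toLoop_of_mem ha, h4, map_zero])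
    · right
      refine A.eq_top_of_comp_le fun z a ha => ?_
      obtain ⟨k, rfl⟩ := QuotientGroup.mk_surjective z
      rw [← A.ofLoop_toLoop_of_mem ha]
      exact (hIhom k _ (A.toLoop_mem k a)).1 (h ▸ Submodule.mem_top)

/-- Each component of a centroid element of `A` lifts to a homogeneous centroid element of the loop
algebra. Components of degree `π(g) ≠ 1` lift to degree `g ∉ H` and vanish; the one of degree `1`
lifts to degree `1` and is a scalar. So the centroid is `F`, and graded simplicity gives simplicity.
-/
theorem isCentralSimple_of_loop (A : GradedAlg.{u, v, w} F (G ⧸ H))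
    (hA : A.loop.IsGradedCentralSimple) (hH : ∀ g, g ∉ H → A.loop.centroidComp g = ⊥) :
    A.IsCentralSimple := by
  refine A.isCentralSimple_of_isGradedSimple (A.isGradedSimple_of_loop hA.1) fun c hc => ?_
  have hcomp : ∀ z, z ≠ 1 → A.homComp c z = 0 := fun z hz => by
    obtain ⟨g, rfl⟩ := QuotientGroup.mk_surjective z
    rw [Ne, QuotientGroup.eq_one_iff] at hz
    have h1 := A.homComp_mem_centroidComp hc (QuotientGroup.mk g)
    have h2 := A.loopShift_mem_centroidComp h1
    rw [hH g hz, Submodule.mem_bot] at h2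
    exact A.loopShift_eq_zero h1 h2
  have h1 := A.homComp_mem_centroidComp hc 1
  obtain ⟨r, hr⟩ := A.loop.isGradedCentral_iff.1 hA.2 _
    (A.loopShift_mem_centroidComp (g := 1) h1)
  have hc1 : ∀ z, ∀ a ∈ A.comp z, A.homComp c 1 a = r • a := fun z a ha => by
    obtain ⟨k, rfl⟩ := QuotientGroup.mk_surjective z
    have h2 := hr (A.toLoop k a)
    rw [A.loopShift_of_mem _ _ (A.toLoop_mem k a), A.ofLoop_toLoop_of_mem ha, one_mul,
      ← map_smul] at h2
    have h3 := congrArg A.ofLoop h2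
    have h4 := h1.2 _ _ ha
    rw [one_mul] at h4
    rwa [A.ofLoop_toLoop_of_mem h4, A.ofLoop_toLoop_of_mem (Submodule.smul_mem _ _ ha)] at h3
  refine ⟨r, fun x => ?_⟩
  have h : c = r • LinearMap.id := A.hom_ext fun y x hx => A.comps_injective (by
    ext z
    obtain ⟨z, rfl⟩ : ∃ z', z' * y = z := ⟨z * y⁻¹, by simp⟩
    rw [← A.homComp_of_mem c z hx, LinearMap.smul_apply, LinearMap.id_apply]
    by_cases hz : z = 1
    · subst hz
      rw [hc1 y x hx, one_mul, A.comps_self (Submodule.smul_mem _ _ hx)]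
    · rw [hcomp z hz, A.comps_ne (Submodule.smul_mem _ _ hx) (by simpa using hz),
        LinearMap.zero_apply])
  rw [h]; rfl

end

end GradedAlg

/-! ### Structure of the centroid, and realization as a twisted loop algebra. -/

namespace GradedAlg

section

variable {F : Type u} [Field F] {G : Type v} [CommGroup G]

/-! ### The centroid of a graded-central-simple algebra -/

theorem mul_mem_centroidComp (B : GradedAlg.{u, v, w} F G) {g k : G}
    {c d : Module.End F B.carrier} (hc : c ∈ B.centroidComp g) (hd : d ∈ B.centroidComp k) :
    c * d ∈ B.centroidComp (g * k) :=
  ⟨Subalgebra.mul_mem _ hc.1 hd.1, fun l x hx => by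
    rw [mul_assoc]
    exact hc.2 _ _ (hd.2 _ _ hx)⟩

theorem comps_apply_of_mem_centroidComp (B : GradedAlg.{u, v, w} F G) {g : G}
    {c : Module.End F B.carrier} (hc : c ∈ B.centroidComp g) (x : B.carrier) (k : G) :
    B.comps (c x) (g * k) = c (B.comps x k) :=
  comps_apply_of_degree B B g c hc.2 x k

/-- Schur's lemma: the kernel and the range are graded ideals. -/
theorem bijective_of_mem_centroidComp (B : GradedAlg.{u, v, w} F G) (hB : B.IsGradedSimple) {g : G}
    {c : Module.End F B.carrier} (hc : c ∈ B.centroidComp g) (hc0 : c ≠ 0) :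
    Function.Bijective c := by
  have hker : B.IsGradedIdeal (LinearMap.ker c) := by
    rw [isGradedIdeal_iff]
    refine ⟨fun a x hx => ?_, fun x hx k => ?_⟩
    · rw [LinearMap.mem_ker] at hx
      rw [LinearMap.mem_ker, LinearMap.mem_ker, (hc.1 a x).2, (hc.1 x a).1, hx]
      simp
    · rw [LinearMap.mem_ker] at hx ⊢
      rw [← B.comps_apply_of_mem_centroidComp hc, hx]
      simp
  have hrange : B.IsGradedIdeal (LinearMap.range c) := by
    rw [isGradedIdeal_iff]
    constructor
    · rintro a _ ⟨x, rfl⟩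
      exact ⟨⟨_, (hc.1 a x).2⟩, ⟨_, (hc.1 x a).1⟩⟩
    · rintro _ ⟨x, rfl⟩ k
      obtain ⟨k, rfl⟩ : ∃ k', g * k' = k := ⟨g⁻¹ * k, by simp⟩
      exact ⟨_, (B.comps_apply_of_mem_centroidComp hc x k).symm⟩
  exact ⟨LinearMap.ker_eq_bot.1 ((hB.2.2 _ hker).resolve_right fun h =>
      hc0 (LinearMap.ker_eq_top.1 h)),
    LinearMap.range_eq_top.1 ((hB.2.2 _ hrange).resolve_left fun h =>
      hc0 (LinearMap.range_eq_bot.1 h))⟩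

theorem exists_inv_of_mem_centroidComp (B : GradedAlg.{u, v, w} F G) (hB : B.IsGradedSimple) {g : G}
    {c : Module.End F B.carrier} (hc : c ∈ B.centroidComp g) (hc0 : c ≠ 0) :
    ∃ d ∈ B.centroidComp g⁻¹, c * d = 1 ∧ d * c = 1 := by
  let e := LinearEquiv.ofBijective c (B.bijective_of_mem_centroidComp hB hc hc0)
  have h1 : ∀ x, c (e.symm x) = x := e.apply_symm_apply
  have h2 : ∀ x, e.symm (c x) = x := e.symm_apply_apply
  refine ⟨(e.symm : B.carrier →ₗ[F] B.carrier), ⟨fun x y => ⟨?_, ?_⟩, fun k x hx => ?_⟩,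
    LinearMap.ext h1, LinearMap.ext h2⟩
  · change e.symm _ = B.mul (e.symm x) y
    rw [e.symm_apply_eq]
    change _ = c _
    rw [(hc.1 _ _).1, h1]
  · change e.symm _ = B.mul x (e.symm y)
    rw [e.symm_apply_eq]
    change _ = c _
    rw [(hc.1 _ _).2, h1]
  · change e.symm x ∈ _
    refine B.mem_comp_of_comps_eq_zero fun l hl => ?_
    have h3 := B.comps_apply_of_mem_centroidComp hc (e.symm x) l
    rw [h1, B.comps_ne hx (fun h => hl (by rw [← h]; simp))] at h3
    exact (B.bijective_of_mem_centroidComp hB hc hc0).1 (by rw [← h3, map_zero])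

/-- The support of the centroid of a graded-simple algebra. -/
def centroidSupport (B : GradedAlg.{u, v, w} F G) (hB : B.IsGradedSimple) : Subgroup G where
  carrier := {g | ∃ c ∈ B.centroidComp g, c ≠ 0}
  one_mem' := by
    have := hB.1
    exact ⟨1, B.one_mem_centroidComp, one_ne_zero⟩
  mul_mem' := by
    rintro g k ⟨c, hc, hc0⟩ ⟨d, hd, hd0⟩
    refine ⟨c * d, B.mul_mem_centroidComp hc hd, fun h => hd0 (LinearMap.ext fun x => ?_)⟩
    exact (B.bijective_of_mem_centroidComp hB hc hc0).1
      ((LinearMap.congr_fun h x).trans (map_zero c).symm)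
  inv_mem' := by
    rintro g ⟨c, hc, hc0⟩
    obtain ⟨d, hd, hcd, -⟩ := B.exists_inv_of_mem_centroidComp hB hc hc0
    refine ⟨d, hd, ?_⟩
    rintro rfl
    have := hB.1
    rw [mul_zero] at hcd
    exact zero_ne_one hcd

theorem centroidComp_eq_bot_of_notMem_support (B : GradedAlg.{u, v, w} F G)
    (hB : B.IsGradedSimple) {g : G} (hg : g ∉ B.centroidSupport hB) : B.centroidComp g = ⊥ := by
  rw [Submodule.eq_bot_iff]
  intro c hc
  by_contra hc0
  exact hg ⟨c, hc, hc0⟩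

/-- `d c⁻¹` is a centroid element of degree `1`, hence a scalar. -/
theorem exists_smul_of_mem_centroidComp (B : GradedAlg.{u, v, w} F G)
    (hB : B.IsGradedCentralSimple) {g : G} {c d : Module.End F B.carrier}
    (hc : c ∈ B.centroidComp g) (hc0 : c ≠ 0) (hd : d ∈ B.centroidComp g) : ∃ r : F, d = r • c := by
  obtain ⟨c', hc', -, h⟩ := B.exists_inv_of_mem_centroidComp hB.1 hc hc0
  have h1 := B.mul_mem_centroidComp hd hc'
  rw [mul_inv_cancel] at h1
  obtain ⟨r, hr⟩ := B.isGradedCentral_iff.1 hB.2 _ h1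
  refine ⟨r, LinearMap.ext fun x => ?_⟩
  have h2 := hr (c x)
  rw [← Module.End.mul_apply, mul_assoc, h, mul_one] at h2
  exact h2

/-- Nonzero homogeneous elements of the centroid multiply according to a symmetric cocycle on the
support. -/
theorem exists_centroid_cocycle (B : GradedAlg.{u, v, w} F G) (hB : B.IsGradedCentralSimple) :
    ∃ (X : B.centroidSupport hB.1 → Module.End F B.carrier)
      (τ : SymCoh.Z2sym (B.centroidSupport hB.1) Fˣ),
      (∀ h : B.centroidSupport hB.1, X h ∈ B.centroidComp (h : G) ∧ X h ≠ 0) ∧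
        ∀ h k, X h * X k = (τ.1 h k : F) • X (h * k) := by
  have hex : ∀ h : B.centroidSupport hB.1, ∃ c, c ∈ B.centroidComp (h : G) ∧ c ≠ 0 := fun h => h.2
  choose X hX using hex
  have hbij : ∀ h, Function.Bijective (X h) := fun h =>
    B.bijective_of_mem_centroidComp hB.1 (hX h).1 (hX h).2
  have := hB.1.1
  have hne : ∀ h k, X h * X k ≠ 0 := fun h k h0 => (hX k).2 (LinearMap.ext fun x =>
    (hbij h).1 ((LinearMap.congr_fun h0 x).trans (map_zero _).symm))
  have hτ : ∀ h k, ∃ r : Fˣ, X h * X k = (r : F) • X (h * k) := fun h k => by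
    obtain ⟨r, hr⟩ := B.exists_smul_of_mem_centroidComp hB (hX (h * k)).1 (hX (h * k)).2
      (B.mul_mem_centroidComp (hX h).1 (hX k).1)
    exact ⟨Units.mk0 r (by rintro rfl; exact hne h k (by rw [hr, zero_smul])), hr⟩
  choose τ hτ using hτ
  refine ⟨X, ⟨τ, fun a b c => ?_, fun a b => ?_⟩, hX, hτ⟩
  · refine Units.ext (smul_left_injective F (hX (a * b * c)).2 ?_)
    have h := mul_assoc (X a) (X b) (X c)
    rw [hτ a b, hτ b c, smul_mul_assoc, mul_smul_comm, hτ, hτ, smul_smul, smul_smul,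
      ← mul_assoc a b c] at h
    simp only [Units.val_mul]
    rw [h, mul_comm]
  · refine Units.ext (smul_left_injective F (hX (a * b)).2 ?_)
    change (τ a b : F) • X (a * b) = (τ b a : F) • X (a * b)
    rw [← hτ, centroid_comm hB.1.2.1 (hX a).1.1 (hX b).1.1, hτ, mul_comm b a]

/-! ### Realization as a loop algebra -/

variable {H : Subgroup G}

/-- If the centroid of `B` contains a copy of the group algebra of `H`, then `B` is isomorphic to
the loop algebra of a `G/H`-graded algebra. -/
theorem exists_loop_iso (B : GradedAlg.{u, v, max v w} F G) (Z : H →* Module.End F B.carrier)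
    (hZ : ∀ h : H, Z h ∈ B.centroidComp (h : G)) :
    ∃ A : GradedAlg.{u, v, max v w} F (G ⧸ H), Nonempty (TwistedEquiv 1 A.loop B) := by
  let s : G ⧸ H → G := Quotient.out
  have hs : ∀ z, (QuotientGroup.mk (s z) : G ⧸ H) = z := fun z => Quotient.out_eq z
  -- `η g` is the element of `H` carrying `g` to the representative of its coset.
  let η : G → H := fun g => ⟨s (QuotientGroup.mk g) * g⁻¹, by
    rw [← QuotientGroup.eq_one_iff, QuotientGroup.mk_mul, hs, QuotientGroup.mk_inv,
      mul_inv_cancel]⟩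
  have hη : ∀ g, (η g : G) * g = s (QuotientGroup.mk g) := fun g => by simp [η]
  have hη' : ∀ (h : H) (g : G), η (h * g) * h = η g := fun h g => by
    have e : (QuotientGroup.mk ((h : G) * g) : G ⧸ H) = QuotientGroup.mk g := by
      rw [QuotientGroup.mk_mul, (QuotientGroup.eq_one_iff _).2 h.2, one_mul]
    refine Subtype.ext ?_
    simp only [η, Subgroup.coe_mul, e]
    rw [mul_inv_rev, mul_assoc, inv_mul_cancel_right]
  have hηs : ∀ z, η (s z) = 1 := fun z => Subtype.ext (by simp [η, hs])
  -- `p` moves every component to the representative of its coset. It is idempotent and constant on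
  -- `H`-orbits, so its range models the quotient of `B` by the relations `Z h x = x`.
  let p : B.carrier →ₗ[F] B.carrier := B.liftHom fun g => Z (η g)
  have hp : ∀ g, ∀ x ∈ B.comp g, p x = Z (η g) x := fun g x hx => B.liftHom_of_mem _ hx
  have hpmem : ∀ g, ∀ x ∈ B.comp g, p x ∈ B.comp (s (QuotientGroup.mk g)) := fun g x hx => by
    rw [hp g x hx, ← hη]
    exact (hZ _).2 _ _ hx
  have hps : ∀ z, ∀ x ∈ B.comp (s z), p x = x := fun z x hx => by
    rw [hp _ x hx, hηs, map_one, Module.End.one_apply]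
  have hpZ : ∀ h x, p (Z h x) = p x := fun h x => by
    have e : p ∘ₗ Z h = p := B.hom_ext fun g x hx => by
      rw [LinearMap.comp_apply, hp _ _ ((hZ h).2 _ _ hx), hp _ _ hx, ← Module.End.mul_apply,
        ← map_mul, hη']
    exact LinearMap.congr_fun e x
  have hpp : ∀ x, p (p x) = p x := fun x => by
    have e : p ∘ₗ p = p := B.hom_ext fun g x hx => by
      rw [LinearMap.comp_apply, hps _ _ (hpmem g x hx)]
    exact LinearMap.congr_fun e x
  have hpmul : ∀ x y, p (B.mul (p x) (p y)) = p (B.mul x y) := fun x y => by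
    have e := B.bilin_ext ((B.mul.compl₁₂ p p).compr₂ p) (B.mul.compr₂ p)
      fun g k x hx y hy => by
        simp only [LinearMap.compr₂_apply, LinearMap.compl₁₂_apply]
        rw [hp _ _ hx, hp _ _ hy, ← ((hZ _).1 _ _).1, hpZ, ← ((hZ _).1 _ _).2, hpZ]
    exact LinearMap.congr_fun₂ e x y
  have hsinj : Function.Injective s := fun y z h => by rw [← hs y, ← hs z, h]
  -- `A` is the range of `p` with product `p(ab)`: a product of representatives must be moved back
  -- to a representative degree. Only the listed properties are used afterwards.
  obtain ⟨A, incl, pr, hip, hpi, hAmul, hAcomp⟩ : ∃ (A : GradedAlg.{u, v, max v w} F (G ⧸ H))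
      (incl : A.carrier →ₗ[F] B.carrier) (pr : B.carrier →ₗ[F] A.carrier),
      (∀ x, incl (pr x) = p x) ∧ (∀ a, pr (incl a) = a) ∧
      (∀ a b, A.mul a b = pr (B.mul (incl a) (incl b))) ∧
      ∀ z a, a ∈ A.comp z ↔ incl a ∈ B.comp (s z) := by
    refine ⟨{
      carrier := LinearMap.range p
      mul := (B.mul.compl₁₂ (LinearMap.range p).subtype (LinearMap.range p).subtype).compr₂
        p.rangeRestrict
      comp := fun z => (B.comp (s z)).comap (LinearMap.range p).subtype
      indep := ?_
      iSup_eq_top := ?_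
      mul_mem := ?_ }, (LinearMap.range p).subtype, p.rangeRestrict, fun x => rfl, ?_,
      fun a b => rfl, fun z a => Iff.rfl⟩
    · intro z
      rw [Submodule.disjoint_def]
      intro a ha ha'
      have hle : ⨆ y, ⨆ (_ : y ≠ z), (B.comp (s y)).comap (LinearMap.range p).subtype ≤
          LinearMap.ker (Finsupp.lapply (s z) ∘ₗ B.comps ∘ₗ (LinearMap.range p).subtype) :=
        iSup₂_le fun y hy x hx => B.comps_ne hx fun h => hy (hsinj h).symm
      have h0 : B.comps a.1 (s z) = 0 := hle ha'
      exact Subtype.ext ((B.comps_self ha).symm.trans h0)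
    · refine (Submodule.eq_top_iff').2 ?_
      rintro ⟨_, x, rfl⟩
      have h := B.eq_top_of_comp_le (P := (⨆ z, (B.comp (s z)).comap
        (LinearMap.range p).subtype).comap p.rangeRestrict) fun g x hx =>
          Submodule.mem_iSup_of_mem (QuotientGroup.mk g) (hpmem g x hx)
      have hx : x ∈ (⊤ : Submodule F B.carrier) := trivial
      rw [← h] at hx
      exact hx
    · intro y z a b ha hb
      have h := hpmem _ _ (B.mul_mem _ _ _ _ ha hb)
      rw [QuotientGroup.mk_mul, hs, hs] at h
      exact h
    · rintro ⟨_, x, rfl⟩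
      exact Subtype.ext (hpp x)
  have hprp : ∀ x, pr (p x) = pr x := fun x => by rw [← hip, hpi]
  have hprZ : ∀ h x, pr (Z h x) = pr x := fun h x => by rw [← hprp, hpZ, hprp]
  have hprmem : ∀ g, ∀ x ∈ B.comp g, pr x ∈ A.comp (QuotientGroup.mk g) := fun g x hx => by
    rw [hAcomp, hip]
    exact hpmem g x hx
  have hprmul : ∀ x y, A.mul (pr x) (pr y) = pr (B.mul x y) := fun x y => by
    rw [hAmul, hip, hip, ← hprp, hpmul, hprp]
  have hback : ∀ k, ∀ x ∈ A.loop.comp k, Z (η k)⁻¹ (incl (A.ofLoop x)) ∈ B.comp k :=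
    fun k x hx => by
      have h := (hZ (η k)⁻¹).2 _ _ ((hAcomp _ _).1 (A.ofLoop_mem hx))
      rwa [← hη, Subgroup.coe_inv, inv_mul_cancel_left] at h
  let α : A.loop.carrier →ₗ[F] B.carrier := A.loop.liftHom fun k => Z (η k)⁻¹ ∘ₗ incl ∘ₗ A.ofLoop
  let β : B.carrier →ₗ[F] A.loop.carrier := B.liftHom fun k => A.toLoop k ∘ₗ pr
  have hα : ∀ k, ∀ x ∈ A.loop.comp k, α x = Z (η k)⁻¹ (incl (A.ofLoop x)) :=
    fun k x hx => A.loop.liftHom_of_mem _ hx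
  have hβ : ∀ k, ∀ x ∈ B.comp k, β x = A.toLoop k (pr x) := fun k x hx => B.liftHom_of_mem _ hx
  have hβα : β ∘ₗ α = LinearMap.id := A.loop.hom_ext fun k x hx => by
    rw [LinearMap.comp_apply, hα k x hx, hβ k _ (hback k x hx), hprZ, hpi, A.toLoop_ofLoop hx,
      LinearMap.id_apply]
  have hαβ : α ∘ₗ β = LinearMap.id := B.hom_ext fun k x hx => by
    rw [LinearMap.comp_apply, hβ k x hx, hα k _ (A.toLoop_mem _ _),
      A.ofLoop_toLoop_of_mem (hprmem k x hx), hip, hp k x hx, ← Module.End.mul_apply, ← map_mul,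
      inv_mul_cancel, map_one, Module.End.one_apply, LinearMap.id_apply]
  let ψ : TwistedEquiv 1 B A.loop :=
    { toEquiv := LinearEquiv.ofLinearMap β α hβα hαβ
      map_mul := fun k l x hx y hy => by
        change A.loop.mul (β x) (β y) = ((1 : Fˣ) : F) • β (B.mul x y)
        rw [hβ k x hx, hβ l y hy, hβ _ _ (B.mul_mem _ _ _ _ hx hy),
          A.loop_mul_toLoop (hprmem k x hx) (hprmem l y hy), hprmul, Units.val_one, one_smul]
      map_mem := fun k x hx => by
        change β x ∈ _
        rw [hβ k x hx]
        exact A.toLoop_mem _ _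
      symm_mem := fun k x hx => by
        change α x ∈ _
        rw [hα k x hx]
        exact hback k x hx }
  exact ⟨A, ⟨ψ.symm.cast inv_one⟩⟩

/-- Every graded-central-simple algebra is a twisted loop algebra of a central simple algebra. -/
theorem exists_twistedLoop_iso (B : GradedAlg.{u, v, max v w} F G) (hB : B.IsGradedCentralSimple)
    (ξ : ∀ H : Subgroup G, SymCoh.H2sym H Fˣ → SymCoh.H2sym G Fˣ)
    (hξ : ∀ H : Subgroup G, Function.RightInverse (ξ H) (SymCoh.H2sym.pullback Fˣ H.subtype)) :
    ∃ (H : Subgroup G) (τ' : SymCoh.H2sym H Fˣ) (A : GradedAlg.{u, v, max v w} F (G ⧸ H))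
      (τ : SymCoh.Z2sym G Fˣ), A.IsCentralSimple ∧
      (QuotientGroup.mk τ : SymCoh.H2sym G Fˣ) = ξ H τ' ∧ Iso (A.twistedLoop τ) B := by
  obtain ⟨X, τ', hX, hXmul⟩ := B.exists_centroid_cocycle hB
  generalize hH : B.centroidSupport hB.1 = H at X τ' hX hXmul
  obtain ⟨τ, hτ⟩ := QuotientGroup.mk_surjective (ξ H (QuotientGroup.mk τ'))
  -- The restriction of `τ` agrees with `τ'` only up to the coboundary of `γ`; rescaling `X h` by
  -- `γ(h)⁻¹` absorbs it, so that the `Y h` multiply by `τ` exactly.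
  obtain ⟨γ, hγ⟩ := exists_coboundary_of_mk_eq (τ := SymCoh.Z2sym.pullback Fˣ H.subtype τ)
    (τ' := τ') ((congrArg (SymCoh.H2sym.pullback Fˣ H.subtype) hτ).trans (hξ H _))
  have hγ' : ∀ h k : H, τ'.1 h k * γ (h * k) = τ.1 h k * (γ h * γ k) := fun h k => by
    rw [← hγ]
    change τ.1 h k * (γ h * γ k * (γ (h * k))⁻¹) * γ (h * k) = _
    rw [mul_assoc, inv_mul_cancel_right]
  let Y : H → Module.End F B.carrier := fun h => (((γ h)⁻¹ : Fˣ) : F) • X h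
  have hY : ∀ h : H, Y h ∈ B.centroidComp (h : G) := fun h => Submodule.smul_mem _ _ (hX h).1
  have hYmul : ∀ h k : H, Y h * Y k = (τ.1 h k : F) • Y (h * k) := fun h k => by
    simp only [Y]
    rw [smul_mul_smul_comm, hXmul, smul_smul, smul_smul]
    congr 1
    simp only [← Units.val_mul]
    congr 1
    have h1 := hγ' h k
    rw [← eq_mul_inv_iff_mul_eq] at h1
    rw [h1]
    have : (γ h)⁻¹ * (γ k)⁻¹ * (τ.1 h k * (γ h * γ k) * (γ (h * k))⁻¹) =
      τ.1 h k * (γ (h * k))⁻¹ * ((γ h)⁻¹ * γ h) * ((γ k)⁻¹ * γ k) := by ac_rfl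
    rw [this]; simp
  have hY0 : ∀ h, Y h ≠ 0 := fun h => smul_ne_zero (Units.ne_zero _) (hX h).2
  clear_value Y
  obtain ⟨φ⟩ := nonempty_twistedEquiv_twist B τ⁻¹
  generalize B.twist τ⁻¹ = B' at φ
  have hB' := φ.isGradedCentralSimple hB
  -- On the untwisted algebra the factors `τ(h, k)` cancel, so the transported elements form an
  -- honest action of `H`.
  let Z : H → Module.End F B'.carrier := fun h => φ.conj (h : G) (Y h)
  have hZ : ∀ h : H, Z h ∈ B'.centroidComp (h : G) := fun h => φ.conj_mem (hY h)
  have hZ0 : ∀ h, Z h ≠ 0 := fun h h0 => hY0 h (φ.conj_eq_zero h0)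
  have hZmul : ∀ h k, Z (h * k) = Z h * Z k := fun h k => B'.hom_ext fun g y hy => by
    obtain ⟨x, rfl⟩ := φ.toEquiv.surjective y
    have hx : x ∈ B.comp g := by simpa using φ.symm_mem _ _ hy
    rw [Module.End.mul_apply]
    simp only [Z]
    rw [φ.conj_apply _ _ hx, φ.conj_apply _ _ hx, map_smul, φ.conj_apply _ _ ((hY k).2 _ _ hx),
      ← Module.End.mul_apply, hYmul, LinearMap.smul_apply, map_smul, smul_smul, smul_smul]
    congr 1
    simp only [← Units.val_mul]
    congr 1
    change (τ.1 ((h * k : H) : G) g)⁻¹ = (τ.1 k g)⁻¹ * (τ.1 h (k * g))⁻¹ * τ.1 h k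
    have h1 := τ.2.1 h k g
    rw [Subgroup.coe_mul, ← mul_inv_rev, ← h1, mul_inv_rev, inv_mul_cancel_right]
  -- `Z 1` is idempotent and injective.
  have hZ1 : Z 1 = 1 := LinearMap.ext fun x => by
    refine (B'.bijective_of_mem_centroidComp hB'.1 (hZ 1) (hZ0 1)).1 ?_
    rw [← Module.End.mul_apply, ← hZmul, one_mul, Module.End.one_apply]
  obtain ⟨A, ⟨ψ⟩⟩ := B'.exists_loop_iso { toFun := Z, map_one' := hZ1, map_mul' := hZmul } hZ
  refine ⟨H, QuotientGroup.mk τ', A, τ, A.isCentralSimple_of_loop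
    (ψ.symm.isGradedCentralSimple hB') fun g hg => ?_, hτ,
    (iso_twist_iff_nonempty _ _ _).2 ⟨(ψ.trans φ.symm).cast (by rw [inv_inv, one_mul])⟩⟩
  rw [(ψ.trans φ.symm).centroidComp_eq_bot_iff]
  exact B.centroidComp_eq_bot_of_notMem_support hB.1 (hH ▸ hg)

end

end GradedAlg

/-! ### The bijection on classes. -/

namespace GradedAlg

section

variable {F : Type u} [Field F] {G : Type v} [CommGroup G]

/-! ### Isomorphism of twisted loop algebras -/

theorem iso_twistedLoop {H : Subgroup G} {A B : GradedAlg.{u, v, w} F (G ⧸ H)} {s : QuotSection H}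
    {χ : H →* Fˣ} (h : Iso (A.charTwist s χ) B) {τ τ' : SymCoh.Z2sym G Fˣ}
    (hτ : (QuotientGroup.mk τ : SymCoh.H2sym G Fˣ) = QuotientGroup.mk τ') :
    Iso (A.twistedLoop τ) (B.twistedLoop τ') := by
  obtain ⟨φ⟩ := nonempty_twistedEquiv_loop_of_charTwist h
  obtain ⟨γ, rfl⟩ := exists_coboundary_of_mk_eq hτ
  exact (iso_twist_twist_iff _ _ _ _).2 ⟨(φ.trans (B.loop.scaleEquiv γ).symm).cast (by
    rw [one_mul, mul_inv, mul_inv_cancel_left])⟩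

end

end GradedAlg

theorem corollary4p5 (F : Type u) [Field F] (G : Type v) [CommGroup G]
    (s : ∀ H : Subgroup G, QuotSection H)
    (ξ : ∀ H : Subgroup G, SymCoh.H2sym H Fˣ → SymCoh.H2sym G Fˣ)
    (hξ : ∀ H : Subgroup G, Function.RightInverse (ξ H) (SymCoh.H2sym.pullback Fˣ H.subtype)) :
    ∃ (hL : ∀ (H : Subgroup G) (τ : SymCoh.Z2sym G Fˣ)
        (A : GradedAlg.{u, v, max v w} F (G ⧸ H)), A.IsCentralSimple →
        (A.twistedLoop τ).IsGradedCentralSimple)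
      (Φ : GradedAlg.Triple.{u, v, max v w} F s → GradedAlg.GCSClass.{u, v, max v w} F G),
      (∀ (H : Subgroup G) (τ' : SymCoh.H2sym H Fˣ)
        (A : {A : GradedAlg.{u, v, max v w} F (G ⧸ H) // A.IsCentralSimple})
        (τ : SymCoh.Z2sym G Fˣ), (QuotientGroup.mk τ : SymCoh.H2sym G Fˣ) = ξ H τ' →
        Φ ⟨H, τ', Quotient.mk (GradedAlg.charSetoid F (s H)) A⟩ =
          Quotient.mk (GradedAlg.gcsSetoid F G) ⟨A.1.twistedLoop τ, hL H τ A.1 A.2⟩) ∧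
      Function.Bijective Φ := by
  have hL : ∀ (H : Subgroup G) (τ : SymCoh.Z2sym G Fˣ)
      (A : GradedAlg.{u, v, max v w} F (G ⧸ H)), A.IsCentralSimple →
      (A.twistedLoop τ).IsGradedCentralSimple :=
    fun H τ A hA => A.isGradedCentralSimple_twistedLoop hA τ
  have hout : ∀ c : SymCoh.H2sym G Fˣ,
      (QuotientGroup.mk (Quotient.out c) : SymCoh.H2sym G Fˣ) = c :=
    fun c => Quotient.out_eq c
  let Φ : GradedAlg.Triple.{u, v, max v w} F s → GradedAlg.GCSClass.{u, v, max v w} F G :=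
    fun T => Quotient.lift (s := GradedAlg.charSetoid F (s T.1))
      (fun A : {A : GradedAlg.{u, v, max v w} F (G ⧸ T.1) // A.IsCentralSimple} =>
        Quotient.mk (GradedAlg.gcsSetoid F G)
          ⟨A.1.twistedLoop (Quotient.out (ξ T.1 T.2.1)), hL T.1 _ A.1 A.2⟩)
      (fun _ _ ⟨_, h⟩ => Quotient.sound (GradedAlg.iso_twistedLoop h rfl)) T.2.2
  have hΦ : ∀ (H : Subgroup G) (τ' : SymCoh.H2sym H Fˣ)
      (A : {A : GradedAlg.{u, v, max v w} F (G ⧸ H) // A.IsCentralSimple})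
      (τ : SymCoh.Z2sym G Fˣ), (QuotientGroup.mk τ : SymCoh.H2sym G Fˣ) = ξ H τ' →
      Φ ⟨H, τ', Quotient.mk (GradedAlg.charSetoid F (s H)) A⟩ =
        Quotient.mk (GradedAlg.gcsSetoid F G) ⟨A.1.twistedLoop τ, hL H τ A.1 A.2⟩ := by
    intro H τ' A τ hτ
    obtain ⟨χ, h⟩ := (GradedAlg.charSetoid F (s H)).refl A
    exact Quotient.sound (GradedAlg.iso_twistedLoop h ((hout _).trans hτ.symm))
  refine ⟨hL, Φ, hΦ, ?_, ?_⟩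
  · rintro ⟨H, τ₁, q₁⟩ ⟨H', τ₂, q₂⟩ he
    induction q₁ using Quotient.inductionOn with | _ A
    induction q₂ using Quotient.inductionOn with | _ B
    rw [hΦ H τ₁ A _ (hout _), hΦ H' τ₂ B _ (hout _)] at he
    have hiso : GradedAlg.Iso _ _ := Quotient.exact he
    obtain ⟨φ⟩ := (GradedAlg.iso_twist_twist_iff _ _ _ _).1 hiso
    obtain rfl := GradedAlg.subgroup_eq_of_twistedEquiv_loop A.2 B.2 φ
    obtain ⟨γ, -, hγ⟩ := GradedAlg.exists_conj_loopShift A.2 B.2 φ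
    -- The quotient of the two cocycles on `G` restricts to a coboundary on `H`, so both have the
    -- same restricted class; since `ξ H` is a section of restriction, these classes are `τ₁` and
    -- `τ₂`.
    obtain rfl : τ₁ = τ₂ := by
      rw [← hξ H τ₁, ← hξ H τ₂, ← hout (ξ H τ₁), ← hout (ξ H τ₂), ← mul_inv_eq_one, ← map_inv,
        ← map_mul]
      refine (QuotientGroup.eq_one_iff
        (SymCoh.Z2sym.pullback Fˣ H.subtype
          (Quotient.out (ξ H τ₁) * (Quotient.out (ξ H τ₂))⁻¹))).2 ?_
      rw [hγ]
      exact ⟨γ, rfl⟩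
    -- Now both sides use the same representative cocycle, so the twists cancel and `φ` is an
    -- isomorphism of the untwisted loop algebras.
    obtain ⟨χ, h⟩ := GradedAlg.exists_charTwist_iso A.2 B.2 (s H)
      (φ.cast (mul_inv_cancel _))
    have hq : Quotient.mk (GradedAlg.charSetoid F (s H)) A =
        Quotient.mk (GradedAlg.charSetoid F (s H)) B := Quotient.sound ⟨χ, h⟩
    rw [hq]
  · intro q
    induction q using Quotient.inductionOn with | _ B
    obtain ⟨H, τ', A, τ, hA, hτ, h⟩ := GradedAlg.exists_twistedLoop_iso.{u, v, w} B.1 B.2 ξ hξ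
    refine ⟨⟨H, τ', Quotient.mk (GradedAlg.charSetoid F (s H)) ⟨A, hA⟩⟩, ?_⟩
    rw [hΦ H τ' ⟨A, hA⟩ τ hτ]
    exact Quotient.sound h
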